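/- Fix real numbers $a<0<b$ and $q\in(0,1]$. **Notation.** A *continual diagram* is a function $w:\mathbb R\to\mathbb R$ with $|w(s_1)-w(s_2)|\le|s_1-s_2|$ for all $s_1,s_2$, for which there is a point $s_0$ (the *center* of $w$) such that $w(s)=|s-s_0|$ when $|s|$ is large enough. $\mathcal D[a,b]$ is the set of continual diagrams with center $s_0\in[a,b]$ and $w(s)=|s-s_0|$ for all $s\notin[a,b]$; $\mathcal M[a,b]$ is the set of Borel probability measures on $[a,b]$. Put $\sigma(s)=\frac12(w(s)-|s|)$. The *Rayleigh measure* $\tau=\tau_w$ of $w\in\mathcal D[a,b]$ is the (generalized) signed measure on $[a,b]$ with distribution function $F(s)=\frac12(1+w'(s))$, that is, the linear functional $$\int_a^b f\,d\tau=f(b)-\int_a^b f'(s)F(s)\,ds$$ on continuously differentiable functions $f:[a,b]\to\mathbb C$ (it is an ordinary signed measure when $F$ has bounded variation). A *Rayleigh measure on $[a,b]$* is the Rayleigh measure of some $w\in\mathcal D[a,b]$. For real $x\notin[a,b]$ put $K_q(x,s)=\dfrac1{1-q^{x-s}}$ if $q<1$ and $K_1(x,s)=\dfrac1{x-s}$.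 For $q<1$ let $$R_\mu(x;q)=(1-q)\int_a^b\frac{\mu(ds)}{1-q^{x-s}},\qquad R_w(x;q)=q^{s_0}\,\frac{1-q}{1-q^x}\exp\Big[-\ln q^{-1}\int_a^b\frac{d\sigma(s)}{1-q^{x-s}}\Big],$$ where $s_0$ is the center of $w$, and for $q=1$ let $$R_\mu(x;1)=\int_a^b\frac{\mu(ds)}{x-s},\qquad R_w(x;1)=\frac1x\exp\Big[\int_a^b\frac{d\sigma(s)}{s-x}\Big].$$ **Theorem.** Consider, for $\mu\in\mathcal M[a,b]$ and a Rayleigh measure $\tau$ on $[a,b]$, the identity $$\int_a^bK_q(x,s)\,\mu(ds)=\exp\int_a^b\ln K_q(x,s)\,\tau(ds)\qquad\text{for all real }x\notin[a,b],\tag{1}$$ where $\ln$ is the principal branch of the logarithm (the real logarithm when $x>b$; for $x<a$ the argument is negative). 1. For every $\mu\in\mathcal M[a,b]$ there is exactly one Rayleigh measure $\tau$ on $[a,b]$ satisfying (1), and for every Rayleigh measure $\tau$ on $[a,b]$ there is exactly one $\mu\in\mathcal M[a,b]$ satisfying (1). Moreover, if the identity holds for all $x>b$, then (1) holds. 2.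 For $w\in\mathcal D[a,b]$ and $\mu\in\mathcal M[a,b]$, the relation $$R_\mu(x;q)=R_w(x;q)\quad\text{for all real }x\notin[a,b]\tag{2}$$ holds if and only if (1) holds with $\tau=\tau_w$. The relation (2) is a bijection between $\mathcal D[a,b]$ and $\mathcal M[a,b]$: for every $w\in\mathcal D[a,b]$ there is exactly one $\mu\in\mathcal M[a,b]$ satisfying (2), and for every $\mu\in\mathcal M[a,b]$ there is exactly one $w\in\mathcal D[a,b]$ satisfying (2). -/

import Mathlib

open Set MeasureTheory

noncomputable section

namespace QMarkovKrein

/-- A continual diagram: a 1-Lipschitz function `w` on the line such that, for some point `s₀`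
(the center of `w`), `w s = |s - s₀|` when `|s|` is large enough. -/
def IsContinualDiagram (w : ℝ → ℝ) : Prop :=
  (∀ s₁ s₂ : ℝ, |w s₁ - w s₂| ≤ |s₁ - s₂|) ∧
    ∃ s₀ C : ℝ, ∀ s : ℝ, C ≤ |s| → w s = |s - s₀|

open Classical in
/-- The center of a continual diagram `w`: the (unique) point `s₀` such that `w s = |s - s₀|` when
`|s|` is large enough. The value `0` is used only for functions that have no center. -/
def center (w : ℝ → ℝ) : ℝ :=
  if h : ∃ s₀ C : ℝ, ∀ s : ℝ, C ≤ |s| → w s = |s - s₀| then h.choose else 0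

/-- The set `𝓓[a,b]` of continual diagrams with `w s = |s - s₀|` for `s ∉ [a,b]`, the center `s₀`
being a point of `[a,b]`. -/
def diagrams (a b : ℝ) : Set (ℝ → ℝ) :=
  {w | IsContinualDiagram w ∧ ∃ s₀ ∈ Icc a b, ∀ s : ℝ, s ∉ Icc a b → w s = |s - s₀|}

/-- The set `𝓜[a,b]` of probability measures on `[a,b]`: Borel probability measures on the line
that give no mass to the complement of `[a,b]`. -/
def probMeasures (a b : ℝ) : Set (Measure ℝ) :=
  {μ | IsProbabilityMeasure μ ∧ μ (Icc a b)ᶜ = 0}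

/-- The charge `σ(s) = (w(s) - |s|) / 2` of a diagram. -/
def charge (w : ℝ → ℝ) (s : ℝ) : ℝ := (w s - |s|) / 2

/-- The kernel `1 / (1 - q ^ (x - s))`; for `q = 1` it is the undeformed kernel `1 / (x - s)`. -/
def kernel (q x s : ℝ) : ℝ :=
  if q = 1 then 1 / (x - s) else 1 / (1 - q ^ (x - s))

/-- The `q`-deformed `R`-function of a measure on `[a,b]`:
`R_μ(x;q) = (1 - q) ∫ μ(ds) / (1 - q ^ (x - s))` for `q ≠ 1`, and
`R_μ(x;1) = ∫ μ(ds) / (x - s)`. -/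
def rMeasure (a b q : ℝ) (μ : Measure ℝ) (x : ℝ) : ℝ :=
  if q = 1 then ∫ s in Icc a b, 1 / (x - s) ∂μ
  else (1 - q) * ∫ s in Icc a b, 1 / (1 - q ^ (x - s)) ∂μ

/-- The `q`-deformed `R`-function of a diagram `w` in `𝓓[a,b]` with center `s₀` and charge `σ`:
`R_w(x;q) = q ^ s₀ * (1 - q) / (1 - q ^ x) * exp (- ln q⁻¹ * ∫ dσ(s) / (1 - q ^ (x - s)))` for
`q ≠ 1`, and `R_w(x;1) = 1 / x * exp (∫ dσ(s) / (s - x))`.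
The charge is a Lipschitz function, so that `dσ(s) = σ'(s) ds`. -/
def rDiagram (a b q : ℝ) (w : ℝ → ℝ) (x : ℝ) : ℝ :=
  if q = 1 then
    1 / x * Real.exp (∫ s in a..b, deriv (charge w) s / (s - x))
  else
    q ^ center w * ((1 - q) / (1 - q ^ x)) *
      Real.exp (-(Real.log q⁻¹ * ∫ s in a..b, deriv (charge w) s / (1 - q ^ (x - s))))

/-- `μ` is the `q`-transition measure of the diagram `w`: the functions `R_μ(x;q)` and `R_w(x;q)`
of the real variable `x ∉ [a,b]` coincide. -/
def IsTransitionMeasure (a b q : ℝ) (w : ℝ → ℝ) (μ : Measure ℝ) : Prop :=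
  ∀ x : ℝ, x ∉ Icc a b → rMeasure a b q μ x = rDiagram a b q w x

/-- The space of (complex-valued) functions that are continuously differentiable on `[a,b]`. -/
def testFunctions (a b : ℝ) : Submodule ℂ (ℝ → ℂ) where
  carrier := {f | ContDiffOn ℝ 1 f (Icc a b)}
  add_mem' hf hg := ContDiffOn.add hf hg
  zero_mem' := contDiffOn_const (c := (0 : ℂ))
  smul_mem' c _ hf := ContDiffOn.const_smul c hf

/-- The function `F(s) = (1 + w'(s)) / 2`, defined almost everywhere. -/
def rayleighFunction (w : ℝ → ℝ) (s : ℝ) : ℝ := (1 + deriv w s) / 2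

lemma norm_deriv_le_of_mem {a b : ℝ} {w : ℝ → ℝ} (hw : w ∈ diagrams a b) (s : ℝ) :
    ‖deriv w s‖ ≤ 1 := by
  have h : LipschitzWith 1 w := LipschitzWith.of_dist_le_mul fun s t => by
    simpa [Real.dist_eq] using hw.1.1 s t
  simpa using norm_deriv_le_of_lipschitz (x₀ := s) h

lemma intervalIntegrable_rayleigh {a b : ℝ} (hab : a < b) {w : ℝ → ℝ} (hw : w ∈ diagrams a b)
    {f : ℝ → ℂ} (hf : ContDiffOn ℝ 1 f (Icc a b)) :
    IntervalIntegrable (fun s => derivWithin f (Icc a b) s * (rayleighFunction w s : ℂ))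
      volume a b := by
  have h1 : ContinuousOn (derivWithin f (Icc a b)) (Icc a b) :=
    hf.continuousOn_derivWithin (uniqueDiffOn_Icc hab) le_rfl
  have h2 : IntervalIntegrable (derivWithin f (Icc a b)) volume a b := by
    apply ContinuousOn.intervalIntegrable
    rwa [uIcc_of_le hab.le]
  rw [intervalIntegrable_iff] at h2 ⊢
  refine h2.mul_bdd (c := 1) ?_ ?_
  · have : Measurable (rayleighFunction w) := by
      unfold rayleighFunction
      exact ((measurable_deriv w).const_add 1).div_const 2
    exact (Complex.measurable_ofReal.comp this).aestronglyMeasurable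
  · refine Filter.Eventually.of_forall fun s => ?_
    have h3 := abs_le.1 (norm_deriv_le_of_mem hw s)
    rw [Complex.norm_real, Real.norm_eq_abs, abs_le]
    unfold rayleighFunction
    constructor <;> linarith [h3.1, h3.2]

/-- The Rayleigh measure `τ` of a diagram `w` in `𝓓[a,b]`, i.e. the generalized signed measure on
`[a,b]` with distribution function `F(s) = (1 + w'(s)) / 2`. Here `F = 0` to the left of `a` and
`F = 1` to the right of `b`, but `F` is in general not of bounded variation, so `τ` is the
Lebesgue-Stieltjes functional
`∫ f dτ = ∫ f dF = f(b) - ∫ f'(s) F(s) ds` (integral over `[a,b]`) on the functions that are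
continuously differentiable on `[a,b]`; it is the integral against an ordinary signed measure
when `F` has bounded variation. -/
def rayleighMeasure {a b : ℝ} (hab : a < b) (w : diagrams a b) : testFunctions a b →ₗ[ℂ] ℂ where
  toFun f := f.1 b - ∫ s in a..b, derivWithin f.1 (Icc a b) s * (rayleighFunction w.1 s : ℂ)
  map_add' f g := by
    have h : (∫ s in a..b, derivWithin (f + g).1 (Icc a b) s * (rayleighFunction w.1 s : ℂ))
        = ∫ s in a..b, (derivWithin f.1 (Icc a b) s * (rayleighFunction w.1 s : ℂ)
          + derivWithin g.1 (Icc a b) s * (rayleighFunction w.1 s : ℂ)) := by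
      apply intervalIntegral.integral_congr
      intro s hs
      rw [uIcc_of_le hab.le] at hs
      have hf := f.2.differentiableOn one_ne_zero s hs
      have hg := g.2.differentiableOn one_ne_zero s hs
      simp only [Submodule.coe_add]
      rw [derivWithin_add hf hg, add_mul]
    rw [h, intervalIntegral.integral_add (intervalIntegrable_rayleigh hab w.2 f.2)
      (intervalIntegrable_rayleigh hab w.2 g.2)]
    simp only [Submodule.coe_add, Pi.add_apply]
    ring
  map_smul' c f := by
    have h : (∫ s in a..b, derivWithin (c • f).1 (Icc a b) s * (rayleighFunction w.1 s : ℂ))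
        = ∫ s in a..b, c * (derivWithin f.1 (Icc a b) s * (rayleighFunction w.1 s : ℂ)) := by
      apply intervalIntegral.integral_congr
      intro s hs
      rw [uIcc_of_le hab.le] at hs
      have hf := f.2.differentiableOn one_ne_zero s hs
      simp only [Submodule.coe_smul]
      rw [derivWithin_const_smul c hf, smul_eq_mul, mul_assoc]
    rw [h, intervalIntegral.integral_const_mul]
    simp only [Submodule.coe_smul, Pi.smul_apply, smul_eq_mul, RingHom.id_apply]
    ring

/-- The set of Rayleigh measures on `[a,b]`: the Rayleigh measures of the diagrams in `𝓓[a,b]`. -/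
def rayleighMeasures {a b : ℝ} (hab : a < b) : Set (testFunctions a b →ₗ[ℂ] ℂ) :=
  range (rayleighMeasure hab)

lemma kernel_sign {a b q x : ℝ} (hq : q ∈ Ioc (0 : ℝ) 1) (hx : x ∉ Icc a b) :
    (∀ s ∈ Icc a b, 0 < kernel q x s) ∨ (∀ s ∈ Icc a b, kernel q x s < 0) := by
  by_cases hxa : a ≤ x
  · have hxb : b < x := not_le.1 fun h => hx ⟨hxa, h⟩
    refine Or.inl fun s hs => ?_
    have hlt : 0 < x - s := by linarith [hs.2]
    unfold kernel
    split_ifs with h1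
    · exact one_div_pos.2 hlt
    · exact one_div_pos.2 (sub_pos.2
        (Real.rpow_lt_one hq.1.le (lt_of_le_of_ne hq.2 h1) hlt))
  · refine Or.inr fun s hs => ?_
    have hlt : x - s < 0 := by linarith [not_le.1 hxa, hs.1]
    unfold kernel
    split_ifs with h1
    · exact one_div_neg.2 hlt
    · exact one_div_neg.2 (sub_neg.2
        (Real.one_lt_rpow_of_pos_of_lt_one_of_neg hq.1 (lt_of_le_of_ne hq.2 h1) hlt))

lemma contDiffOn_kernel {a b q x : ℝ} (hq : q ∈ Ioc (0 : ℝ) 1) (hx : x ∉ Icc a b) :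
    ContDiffOn ℝ 1 (kernel q x) (Icc a b) := by
  have hne : ∀ s ∈ Icc a b, kernel q x s ≠ 0 := fun s hs =>
    (kernel_sign hq hx).elim (fun h => (h s hs).ne') (fun h => (h s hs).ne)
  by_cases h1 : q = 1
  · have h2 : kernel q x = fun s => 1 / (x - s) := by ext s; simp [kernel, h1]
    rw [h2] at hne ⊢
    refine contDiffOn_const.div (contDiffOn_const.sub contDiffOn_id) fun s hs h => ?_
    exact hne s hs (show 1 / (x - s) = 0 by rw [show x - s = 0 from h, div_zero])
  · have h2 : kernel q x = fun s => 1 / (1 - q ^ (x - s)) := by ext s; simp [kernel, h1]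
    rw [h2] at hne ⊢
    refine contDiffOn_const.div (contDiffOn_const.sub ?_) fun s hs h => ?_
    · have h3 : (fun s : ℝ => q ^ (x - s)) = fun s => Real.exp (Real.log q * (x - s)) := by
        ext s; rw [Real.rpow_def_of_pos hq.1]
      rw [h3]
      exact (Real.contDiff_exp.comp
        (contDiff_const.mul (contDiff_const.sub contDiff_id))).contDiffOn
    · exact hne s hs (show 1 / (1 - q ^ (x - s)) = 0 by rw [show 1 - q ^ (x - s) = 0 from h, div_zero])

lemma contDiffOn_log_kernel {a b q x : ℝ} (hq : q ∈ Ioc (0 : ℝ) 1) (hx : x ∉ Icc a b) :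
    ContDiffOn ℝ 1 (fun s : ℝ => Complex.log (kernel q x s : ℂ)) (Icc a b) := by
  have hk := contDiffOn_kernel hq hx
  rcases kernel_sign hq hx with hs | hs
  · refine (Complex.ofRealCLM.contDiff.comp_contDiffOn
      (hk.log fun s h => (hs s h).ne')).congr fun s h => ?_
    simp [Complex.ofReal_log (hs s h).le]
  · refine ((Complex.ofRealCLM.contDiff.comp_contDiffOn
      (hk.log fun s h => (hs s h).ne)).add
        (contDiffOn_const (c := (Real.pi * Complex.I : ℂ)))).congr fun s h => ?_
    have h2 := Complex.log_ofReal_mul (r := -kernel q x s) (x := -1)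
      (neg_pos.2 (hs s h)) (by norm_num)
    rw [Complex.log_neg_one, Real.log_neg_eq_log] at h2
    simpa using h2

/-- For `x ∉ [a,b]`, the function `s ↦ ln (1 / (1 - q ^ (x - s)))` on `[a,b]` (for `q = 1`, the
function `s ↦ ln (1 / (x - s))`), as a test function. The logarithm is the principal branch:
it is the real logarithm for `x > b`, while for `x < a` its argument is a negative number. -/
def logKernel {a b q x : ℝ} (hq : q ∈ Ioc (0 : ℝ) 1) (hx : x ∉ Icc a b) : testFunctions a b :=
  ⟨fun s => Complex.log (kernel q x s : ℂ), contDiffOn_log_kernel hq hx⟩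

/-- The `q`-Markov-Krein identity at the point `x ∉ [a,b]`:
`∫ μ(ds) / (1 - q ^ (x - s)) = exp (∫ ln (1 / (1 - q ^ (x - s))) τ(ds))`, with `1 / (x - s)` in
place of `1 / (1 - q ^ (x - s))` for `q = 1`. -/
def MarkovKreinAt {a b q : ℝ} (hq : q ∈ Ioc (0 : ℝ) 1) (μ : Measure ℝ)
    (τ : testFunctions a b →ₗ[ℂ] ℂ) {x : ℝ} (hx : x ∉ Icc a b) : Prop :=
  ((∫ s in Icc a b, kernel q x s ∂μ : ℝ) : ℂ) = Complex.exp (τ (logKernel hq hx))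

/-- The `q`-Markov-Krein identity for all real `x ∉ [a,b]`. -/
def MarkovKrein {a b q : ℝ} (hq : q ∈ Ioc (0 : ℝ) 1) (μ : Measure ℝ)
    (τ : testFunctions a b →ₗ[ℂ] ℂ) : Prop :=
  ∀ (x : ℝ) (hx : x ∉ Icc a b), MarkovKreinAt hq μ τ hx

end QMarkovKrein

end

namespace QMarkovKrein

/-! ### Partial fractions with interlacing zeros and poles -/

section Interlacing

open Finset Polynomial

/-! Put `φ(s) = q^(-s)` (or `φ(s) = s` if `q = 1`), `ψ = φ'` and `X = φ(x)`. Up to a nonzero factor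
depending only on `x`, the kernel is the Cauchy kernel `1/(X - φ(s))`. The functional `τ` is already
written in integrated-by-parts form, so the identity becomes, with `F = (1 + w')/2`, `∫ μ(ds)/(X -
φ(s)) = 1/(X - φ(b)) * exp(-∫ F(s) ψ(s)/(X - φ(s)) ds)`. Diagrams correspond to measurable densities
`F` with values in `[0,1]`, modulo null sets (`exists_diagram`, `diagram_unique`). Everything
reduces to a bijection between such densities and probability measures, proved for an arbitrary
increasing `C¹` change of variable `φ` (`IsChart`).

Existence is explicit on a grid. If `F` is the indicator of intervals `[u_k, d_k]`, each starting at
a grid point and staying in its cell, the right side is a rational function with poles `φ(u_k)` and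
interlacing zeros `φ(d_k)`. Interlacing is what makes the partial fraction coefficients nonnegative
(`exists_weights_of_interlacing`), and conversely positive weights force interlacing zeros
(`exists_interlacing_of_weights`). A general `μ` or `F` is a weak limit of grid data. The other side
of the identity is then extracted by compactness: Banach-Alaoglu in `L²` for densities, compactness
of the probability measures on `[a,b]` for measures. This gives `IsChart.exists_density` and
`IsChart.exists_measure`.

Uniqueness needs only `X > φ(b)`: behaviour as `X → ∞` yields all moments in `φ`, and
Stone-Weierstrass finishes (`IsChart.functional_eq_zero`). This is also why the identity for `x > b`
implies it everywhere.

For the `R`-functions, the charge satisfies `σ' = F - 1_(0,∞)` almost everywhere, and `rDiagram_eq`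
shows that relation (2) is the same identity multiplied by a nonzero constant. -/

lemma prod_erase_range_succ {M : Type*} [CommMonoid M] {n i : ℕ} (hi : i ≤ n) (g : ℕ → M) :
    ∏ j ∈ (range (n + 1)).erase i, g j = (∏ j ∈ range i, g j) * ∏ j ∈ Ico i n, g (j + 1) := by
  have h : (range (n + 1)).erase i = range i ∪ Ico (i + 1) (n + 1) := by
    ext j; simp only [mem_erase, Finset.mem_range, Finset.mem_union, Finset.mem_Ico]; omega
  rw [h, Finset.prod_union, Finset.prod_Ico_add' g i n 1]
  rw [Finset.disjoint_left]
  intro j hj hj'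
  simp only [Finset.mem_range, Finset.mem_Ico] at hj hj'
  omega

/-- A proper rational function whose simple poles interlace its zeros is the Cauchy transform of a
probability measure on the poles. -/
lemma exists_weights_of_interlacing {u v : ℕ → ℝ} (hu : StrictMono u)
    (hv : ∀ k, v k ∈ Set.Icc (u k) (u (k + 1))) (n : ℕ) :
    ∃ p : ℕ → ℝ, (∀ k ∈ range (n + 1), 0 ≤ p k) ∧ ∑ k ∈ range (n + 1), p k = 1 ∧
      ∀ X : ℝ, (∀ k ∈ range (n + 1), X ≠ u k) →
        ∑ k ∈ range (n + 1), p k / (X - u k) =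
          (∏ k ∈ range n, (X - v k)) / ∏ k ∈ range (n + 1), (X - u k) := by
  set f : ℝ[X] := Lagrange.nodal (range n) v with hf
  have hinj : Set.InjOn u (Finset.range (n + 1)) := hu.injective.injOn
  have hdeg : f.degree < #(range (n + 1)) := by
    rw [hf, Lagrange.degree_nodal, card_range, card_range]; exact_mod_cast Nat.lt_succ_self n
  refine ⟨fun k => Lagrange.nodalWeight (range (n + 1)) u k * f.eval (u k), ?_, ?_, ?_⟩
  · intro i hi
    have hi' : i ≤ n := by simpa [Nat.lt_succ_iff] using hi
    have e1 : f.eval (u i) = (∏ j ∈ range i, (u i - v j)) * ∏ j ∈ Finset.Ico i n, (u i - v j) := by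
      rw [hf, Lagrange.eval_nodal, prod_range_mul_prod_Ico _ hi']
    have e2 := prod_erase_range_succ hi' (fun j => (u i - u j)⁻¹)
    simp only [Lagrange.nodalWeight]
    -- Pair `u i - v j` with `u i - u j` for `j < i`, and with `u i - u (j + 1)` for `j ≥ i`. By
    -- interlacing the two members of each pair never have opposite signs.
    rw [e1, e2, mul_mul_mul_comm, ← prod_mul_distrib, ← prod_mul_distrib]
    refine mul_nonneg (prod_nonneg fun j hj => ?_) (prod_nonneg fun j hj => ?_)
    · have hj' : j + 1 ≤ i := by simpa using hj
      have h1 := hu.monotone hj'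
      have h2 := (hv j).2
      have h3 := hu (show j < i from hj')
      exact mul_nonneg (inv_nonneg.2 (by linarith)) (by linarith)
    · have hj' : i ≤ j := (Finset.mem_Ico.1 hj).1
      have h1 := hu.monotone hj'
      have h2 := (hv j).1
      have h3 := hu (show i < j + 1 by omega)
      exact mul_nonneg_of_nonpos_of_nonpos (inv_nonpos.2 (by linarith)) (by linarith)
  · have h := Lagrange.leadingCoeff_eq_sum (s := range (n + 1)) hinj (P := f)
      (by rw [hf, Lagrange.degree_nodal]; simp)
    rw [hf, Lagrange.nodal_monic.leadingCoeff] at h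
    rw [h]
    refine sum_congr rfl fun i _ => ?_
    simp only [Lagrange.nodalWeight, prod_inv_distrib, div_eq_inv_mul, hf]
  · intro X hX
    have h := Lagrange.eval_interpolate_not_at_node (fun i => f.eval (u i)) hX
    rw [← Lagrange.eq_interpolate hinj hdeg, hf, Lagrange.eval_nodal, Lagrange.eval_nodal] at h
    have hne : ∏ k ∈ range (n + 1), (X - u k) ≠ 0 :=
      prod_ne_zero_iff.2 fun k hk => sub_ne_zero.2 (hX k hk)
    rw [h, mul_div_cancel_left₀ _ hne]
    refine sum_congr rfl fun i _ => ?_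
    rw [div_eq_mul_inv]; ring

/-- Exactly the `n - i` factors with index above `i` are negative. -/
lemma sign_prod_erase {u : ℕ → ℝ} (hu : StrictMono u) {n i : ℕ} (hi : i ≤ n) :
    0 < (-1) ^ (n - i) * ∏ j ∈ (range (n + 1)).erase i, (u i - u j) := by
  rw [prod_erase_range_succ hi, mul_left_comm]
  refine mul_pos (prod_pos fun j hj => sub_pos.2 (hu (Finset.mem_range.1 hj))) ?_
  have : ((-1 : ℝ)) ^ (n - i) = ∏ j ∈ Finset.Ico i n, (-1 : ℝ) := by simp
  rw [this, ← prod_mul_distrib]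
  refine prod_pos fun j hj => ?_
  have := hu (show i < j + 1 by have := (Finset.mem_Ico.1 hj).1; omega)
  linarith

/-- The Cauchy transform of a probability measure with positive weights on finitely many points has
zeros that interlace the points. -/
lemma exists_interlacing_of_weights {u p : ℕ → ℝ} (hu : StrictMono u) (n : ℕ)
    (hp : ∀ k ∈ range (n + 1), 0 < p k) (hsum : ∑ k ∈ range (n + 1), p k = 1) :
    ∃ v : ℕ → ℝ, (∀ k, v k ∈ Set.Icc (u k) (u (k + 1))) ∧
      ∀ X : ℝ, (∀ k ∈ range (n + 1), X ≠ u k) →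
        ∑ k ∈ range (n + 1), p k / (X - u k) =
          (∏ k ∈ range n, (X - v k)) / ∏ k ∈ range (n + 1), (X - u k) := by
  set P : ℝ[X] := ∑ k ∈ range (n + 1), C (p k) * Lagrange.nodal ((range (n + 1)).erase k) u with hP
  have hcard : ∀ k ∈ range (n + 1), #((range (n + 1)).erase k) = n := fun k hk => by
    rw [card_erase_of_mem hk]; simp
  have hPu : ∀ i ∈ range (n + 1),
      P.eval (u i) = p i * ∏ j ∈ (range (n + 1)).erase i, (u i - u j) := by
    intro i hi
    rw [hP, eval_finsetSum, sum_eq_single_of_mem i hi]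
    · simp [Lagrange.eval_nodal]
    · intro j _ hji
      rw [eval_mul, Lagrange.eval_nodal_at_node (mem_erase.2 ⟨hji.symm, hi⟩), mul_zero]
  -- The numerator `P` alternates in sign along the poles, so it has a root strictly between any two
  -- consecutive ones.
  have hsign : ∀ i ≤ n, 0 < (-1) ^ (n - i) * P.eval (u i) := fun i hi => by
    have hi' : i ∈ range (n + 1) := by simpa [Nat.lt_succ_iff] using hi
    rw [hPu i hi', mul_left_comm]
    exact mul_pos (hp i hi') (sign_prod_erase hu hi)
  have hroot : ∀ k, ∃ y, y ∈ Set.Icc (u k) (u (k + 1)) ∧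
      (k < n → y ∈ Set.Ioo (u k) (u (k + 1)) ∧ P.eval y = 0) := by
    intro k
    by_cases hk : k < n
    · have h1 := hsign k hk.le
      have h2 := hsign (k + 1) hk
      have hle := (hu (Nat.lt_succ_self k)).le
      rw [show n - k = n - (k + 1) + 1 by omega, pow_succ] at h1
      set e : ℝ := (-1) ^ (n - (k + 1))
      have hc : ContinuousOn (fun y => e * P.eval y) (Set.Icc (u k) (u (k + 1))) := by fun_prop
      obtain ⟨y, hy, hy0⟩ := intermediate_value_Ioo hle hc
        (show (0 : ℝ) ∈ Set.Ioo _ _ from ⟨by linarith, h2⟩)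
      refine ⟨y, Ioo_subset_Icc_self hy, fun _ => ⟨hy, ?_⟩⟩
      exact (mul_eq_zero.1 hy0).resolve_left (pow_ne_zero _ (by norm_num))
    -- Only the first `n` roots matter; beyond them `u k` is a filler inside the required interval.
    · exact ⟨u k, ⟨le_rfl, (hu (Nat.lt_succ_self k)).le⟩, fun h => absurd h hk⟩
  choose v hv hv' using hroot
  have hvinj : Set.InjOn v (Finset.range n) := by
    have hlt : ∀ i ∈ range n, ∀ j ∈ range n, i < j → v i < v j := fun i hi j hj hij =>
      ((hv' i (Finset.mem_range.1 hi)).1.2.trans_le (hu.monotone (Nat.succ_le_of_lt hij))).trans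
        (hv' j (Finset.mem_range.1 hj)).1.1
    intro i hi j hj hij
    rcases lt_trichotomy i j with h | h | h
    · exact absurd hij (hlt i hi j hj h).ne
    · exact h
    · exact absurd hij (hlt j hj i hi h).ne'
  -- Both polynomials are monic of degree `n`, monicity of `P` being the condition that the weights
  -- sum to `1`. Their difference has degree below `n` and vanishes at `n` distinct points.
  have hPeq : P = Lagrange.nodal (range n) v := by
    refine Polynomial.eq_of_degree_sub_lt_of_eval_index_eq (range n) hvinj ?_ ?_
    · have hnle : ∀ s : Finset ℕ, ∀ w : ℕ → ℝ, #s = n → (Lagrange.nodal s w).degree ≤ n ∧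
          (Lagrange.nodal s w).coeff n = 1 := fun s w hs => by
        refine ⟨by rw [Lagrange.degree_nodal, hs], ?_⟩
        have := (Lagrange.nodal_monic (s := s) (v := w)).coeff_natDegree
        rwa [Lagrange.natDegree_nodal, hs] at this
      rw [card_range, degree_lt_iff_coeff_zero]
      intro m hm
      rcases hm.eq_or_lt with rfl | hm
      · rw [coeff_sub, (hnle (range n) v (card_range n)).2, hP, finsetSum_coeff]
        simp_rw [coeff_C_mul]
        rw [sum_congr rfl fun k hk => by rw [(hnle _ u (hcard k hk)).2, mul_one], hsum, sub_self]
      · have hz : ∀ s : Finset ℕ, ∀ w : ℕ → ℝ, #s = n → (Lagrange.nodal s w).coeff m = 0 :=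
          fun s w hs => coeff_eq_zero_of_degree_lt
            ((hnle s w hs).1.trans_lt (by exact_mod_cast hm))
        rw [coeff_sub, hz _ v (card_range n), hP, finsetSum_coeff]
        simp_rw [coeff_C_mul]
        rw [sum_congr rfl fun k hk => by rw [hz _ u (hcard k hk), mul_zero]]
        simp
    · intro i hi
      rw [(hv' i (Finset.mem_range.1 hi)).2, Lagrange.eval_nodal_at_node hi]
  refine ⟨v, hv, fun X hX => ?_⟩
  rw [← Lagrange.eval_nodal, ← hPeq, hP, eval_finsetSum, sum_div]
  refine sum_congr rfl fun k hk => ?_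
  have hne : ∏ j ∈ (range (n + 1)).erase k, (X - u j) ≠ 0 :=
    prod_ne_zero_iff.2 fun j hj => sub_ne_zero.2 (hX j (mem_of_mem_erase hj))
  rw [eval_mul, eval_C, Lagrange.eval_nodal, ← mul_prod_erase _ _ hk, mul_div_mul_right _ _ hne]

end Interlacing

/-! ### Changes of variable on the line -/

/-- `φ` is a change of variable on the line with continuous positive derivative `ψ`. -/
structure IsChart (φ ψ : ℝ → ℝ) : Prop where
  hasDerivAt : ∀ s, HasDerivAt φ (ψ s) s
  continuous_deriv : Continuous ψ
  deriv_pos : ∀ s, 0 < ψ s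

namespace IsChart

variable {φ ψ : ℝ → ℝ} (h : IsChart φ ψ) {a b X : ℝ}

include h

lemma strictMono : StrictMono φ :=
  strictMono_of_deriv_pos fun s => by rw [(h.hasDerivAt s).deriv]; exact h.deriv_pos s

lemma continuous : Continuous φ :=
  continuous_iff_continuousAt.2 fun s => (h.hasDerivAt s).continuousAt

lemma sub_ne_zero (hX : X ∉ Icc (φ a) (φ b)) {s : ℝ} (hs : s ∈ Icc a b) : X - φ s ≠ 0 := by
  intro h0
  rw [sub_eq_zero.1 h0] at hX
  exact hX ⟨h.strictMono.monotone hs.1, h.strictMono.monotone hs.2⟩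

lemma div_sub_pos (hX : X ∉ Icc (φ a) (φ b)) {c d : ℝ} (hc : c ∈ Icc a b) (hd : d ∈ Icc a b) :
    0 < (X - φ c) / (X - φ d) := by
  rcases not_and_or.1 hX with h1 | h1
  · have h2 := h.strictMono.monotone hc.1
    have h3 := h.strictMono.monotone hd.1
    exact div_pos_of_neg_of_neg (by linarith) (by linarith)
  · have h2 := h.strictMono.monotone hc.2
    have h3 := h.strictMono.monotone hd.2
    exact div_pos (by linarith) (by linarith)

lemma continuousOn_inv (hX : X ∉ Icc (φ a) (φ b)) :
    ContinuousOn (fun s => 1 / (X - φ s)) (Icc a b) :=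
  continuousOn_const.div (continuousOn_const.sub h.continuous.continuousOn)
    fun _ hs => h.sub_ne_zero hX hs

lemma continuousOn_logDeriv (hX : X ∉ Icc (φ a) (φ b)) :
    ContinuousOn (fun s => ψ s / (X - φ s)) (Icc a b) :=
  h.continuous_deriv.continuousOn.div (continuousOn_const.sub h.continuous.continuousOn)
    fun _ hs => h.sub_ne_zero hX hs

/-- A primitive of the integrand is `-log |X - φ|`, and `X - φ` keeps one sign on `[a,b]`. Since
`Real.log` ignores signs, both sides of the interval are covered at once. -/
lemma exp_integral (hX : X ∉ Icc (φ a) (φ b)) {c d : ℝ} (hc : c ∈ Icc a b) (hd : d ∈ Icc a b) :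
    Real.exp (∫ s in c..d, ψ s / (X - φ s)) = (X - φ c) / (X - φ d) := by
  have hsub : uIcc c d ⊆ Icc a b := ordConnected_Icc.uIcc_subset hc hd
  have hI : ∫ s in c..d, ψ s / (X - φ s) = -Real.log (X - φ d) - -Real.log (X - φ c) := by
    refine intervalIntegral.integral_eq_sub_of_hasDerivAt (f := fun s => -Real.log (X - φ s))
      (fun s hs => ?_) ((h.continuousOn_logDeriv hX).mono hsub).intervalIntegrable
    have := (((h.hasDerivAt s).const_sub X).log (h.sub_ne_zero hX (hsub hs))).neg
    exact this.congr_deriv (by ring)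
  rw [hI, ← Real.exp_log (h.div_sub_pos hX hc hd),
    Real.log_div (h.sub_ne_zero hX hc) (h.sub_ne_zero hX hd)]
  congr 1
  ring

end IsChart

/-! ### Equally spaced points -/

/-- The point `a + k (b - a) / n`. -/
noncomputable def gridPoint (a b : ℝ) (n k : ℕ) : ℝ := a + k * ((b - a) / n)

section Grid

variable {a b : ℝ} {n : ℕ}

lemma gridPoint_strictMono (hab : a < b) (hn : 0 < n) : StrictMono (gridPoint a b n) := by
  intro i j hij
  have : 0 < (b - a) / n := div_pos (sub_pos.2 hab) (by exact_mod_cast hn)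
  have hij' : (i : ℝ) < j := by exact_mod_cast hij
  unfold gridPoint
  nlinarith

@[simp] lemma gridPoint_zero : gridPoint a b n 0 = a := by simp [gridPoint]

lemma gridPoint_self (hn : 0 < n) : gridPoint a b n n = b := by
  have : (n : ℝ) ≠ 0 := by exact_mod_cast hn.ne'
  unfold gridPoint
  field_simp
  ring

lemma gridPoint_succ (k : ℕ) : gridPoint a b n (k + 1) = gridPoint a b n k + (b - a) / n := by
  unfold gridPoint
  push_cast
  ring

lemma gridPoint_mem (hab : a < b) (hn : 0 < n) {k : ℕ} (hk : k ≤ n) :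
    gridPoint a b n k ∈ Icc a b := by
  have hm := (gridPoint_strictMono hab hn).monotone
  constructor
  · simpa using hm (Nat.zero_le k)
  · simpa [gridPoint_self hn] using hm hk

/-- The product of the elementary ratios attached to the intervals `[c k, d k]` of a grid, as an
exponential of an integral. -/
lemma IsChart.prod_div_prod_eq {φ ψ : ℝ → ℝ} (h : IsChart φ ψ) (hab : a < b) (hn : 0 < n) {X : ℝ}
    (hX : X ∉ Icc (φ a) (φ b)) {d : ℕ → ℝ} (hd : ∀ k < n, d k ∈ Icc a b) :
    (∏ k ∈ Finset.range n, (X - φ (d k))) / ∏ k ∈ Finset.range (n + 1), (X - φ (gridPoint a b n k)) =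
      1 / (X - φ b) *
        Real.exp (-∑ k ∈ Finset.range n, ∫ s in gridPoint a b n k..d k, ψ s / (X - φ s)) := by
  -- There is one more pole than zeros: the last pole `φ b` gives the prefactor, and the others pair
  -- with the zeros cell by cell.
  rw [Finset.prod_range_succ, gridPoint_self hn, ← Finset.sum_neg_distrib, Real.exp_sum,
    ← div_div, ← Finset.prod_div_distrib, div_eq_inv_mul, one_div]
  congr 1
  refine Finset.prod_congr rfl fun k hk => ?_
  have hk := Finset.mem_range.1 hk
  rw [Real.exp_neg, h.exp_integral hX (gridPoint_mem hab hn hk.le) (hd k hk), inv_div]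

lemma IsChart.gridPoint_notMem {φ ψ : ℝ → ℝ} (h : IsChart φ ψ) (hab : a < b) (hn : 0 < n) {X : ℝ}
    (hX : X ∉ Icc (φ a) (φ b)) : ∀ k ∈ Finset.range (n + 1), X ≠ φ (gridPoint a b n k) := by
  intro k hk
  exact _root_.sub_ne_zero.1
    (h.sub_ne_zero hX (gridPoint_mem hab hn (by simpa [Nat.lt_succ_iff] using hk)))

/-- Intervals inside the cells of a grid determine a probability measure on the grid. -/
lemma IsChart.exists_weights {φ ψ : ℝ → ℝ} (h : IsChart φ ψ) (hab : a < b) (hn : 0 < n)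
    {d : ℕ → ℝ} (hd : ∀ k, d k ∈ Icc (gridPoint a b n k) (gridPoint a b n (k + 1))) :
    ∃ p : ℕ → ℝ, (∀ k ∈ Finset.range (n + 1), 0 ≤ p k) ∧ ∑ k ∈ Finset.range (n + 1), p k = 1 ∧
      ∀ X ∉ Icc (φ a) (φ b),
        ∑ k ∈ Finset.range (n + 1), p k * (1 / (X - φ (gridPoint a b n k))) = 1 / (X - φ b) *
          Real.exp (-∑ k ∈ Finset.range n, ∫ s in gridPoint a b n k..d k, ψ s / (X - φ s)) := by
  have hm := h.strictMono.monotone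
  obtain ⟨p, hp, hp1, hpX⟩ := exists_weights_of_interlacing
    (u := fun k => φ (gridPoint a b n k)) (v := fun k => φ (d k))
    (h.strictMono.comp (gridPoint_strictMono hab hn)) (fun k => ⟨hm (hd k).1, hm (hd k).2⟩) n
  refine ⟨p, hp, hp1, fun X hX => ?_⟩
  have hd' : ∀ k < n, d k ∈ Icc a b := fun k hk =>
    ⟨(gridPoint_mem hab hn hk.le).1.trans (hd k).1, (hd k).2.trans (gridPoint_mem hab hn hk).2⟩
  rw [← h.prod_div_prod_eq hab hn hX hd', ← hpX X (h.gridPoint_notMem hab hn hX)]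
  exact Finset.sum_congr rfl fun k _ => mul_one_div _ _

/-- A probability measure with positive weights on a grid determines intervals inside the cells. -/
lemma IsChart.exists_intervals {φ ψ : ℝ → ℝ} (h : IsChart φ ψ) (hab : a < b) (hn : 0 < n)
    {p : ℕ → ℝ} (hp : ∀ k ∈ Finset.range (n + 1), 0 < p k)
    (hp1 : ∑ k ∈ Finset.range (n + 1), p k = 1) :
    ∃ d : ℕ → ℝ, (∀ k, d k ∈ Icc (gridPoint a b n k) (gridPoint a b n (k + 1))) ∧
      ∀ X ∉ Icc (φ a) (φ b),
        ∑ k ∈ Finset.range (n + 1), p k * (1 / (X - φ (gridPoint a b n k))) = 1 / (X - φ b) *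
          Real.exp (-∑ k ∈ Finset.range n, ∫ s in gridPoint a b n k..d k, ψ s / (X - φ s)) := by
  obtain ⟨v, hv, hvX⟩ := exists_interlacing_of_weights
    (u := fun k => φ (gridPoint a b n k))
    (h.strictMono.comp (gridPoint_strictMono hab hn)) n hp hp1
  have hiv : ∀ k, ∃ d ∈ Icc (gridPoint a b n k) (gridPoint a b n (k + 1)), φ d = v k := fun k =>
    intermediate_value_Icc (gridPoint_strictMono hab hn (Nat.lt_succ_self k)).le
      h.continuous.continuousOn (hv k)
  choose d hd hdv using hiv
  refine ⟨d, hd, fun X hX => ?_⟩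
  have hd' : ∀ k < n, d k ∈ Icc a b := fun k hk =>
    ⟨(gridPoint_mem hab hn hk.le).1.trans (hd k).1, (hd k).2.trans (gridPoint_mem hab hn hk).2⟩
  rw [← h.prod_div_prod_eq hab hn hX hd']
  simp_rw [hdv]
  rw [← hvX X (h.gridPoint_notMem hab hn hX)]
  exact Finset.sum_congr rfl fun k _ => mul_one_div _ _

end Grid

/-! ### Compactness -/

section Compactness

open Filter Topology

/-- Along an ultrafilter, a sequence of subsets of `[a,b]` converges weakly to a density with values
in `[0,1]`. -/
lemma exists_density_limit (a b : ℝ) (l : Ultrafilter ℕ) {U : ℕ → Set ℝ}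
    (hU : ∀ n, MeasurableSet (U n)) :
    ∃ F : ℝ → ℝ, Measurable F ∧ (∀ s, F s ∈ Icc (0 : ℝ) 1) ∧ ∀ g : ℝ → ℝ, ContinuousOn g (Icc a b) →
      Tendsto (fun n => ∫ s in U n ∩ Icc a b, g s) l (𝓝 (∫ s in Icc a b, F s * g s)) := by
  set ν : Measure ℝ := volume.restrict (Icc a b) with hν
  have hνfin : ∀ E : Set ℝ, ν E ≠ ⊤ := fun E => measure_ne_top ν E
  -- The indicators, seen as functionals on `L²`, lie in a fixed ball, which is weak-* compact. The
  -- limit functional is represented by an `L²` function `G`.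
  let φ : ℕ → WeakDual ℝ (Lp ℝ 2 ν) := fun n =>
    StrongDual.toWeakDual (InnerProductSpace.toDual ℝ (Lp ℝ 2 ν)
      (indicatorConstLp 2 (hU n) (hνfin _) (1 : ℝ)))
  have hφ : ∀ n (g : Lp ℝ 2 ν), φ n g = ∫ s in U n, g s ∂ν := fun n g =>
    L2.inner_indicatorConstLp_one (hU n) (hνfin _) g
  set R : ℝ := ν.real univ ^ (1 / (2 : ENNReal).toReal) with hR
  have hmem : ∀ n, φ n ∈ WeakDual.toStrongDual ⁻¹'
      Metric.closedBall (0 : StrongDual ℝ (Lp ℝ 2 ν)) R := by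
    intro n
    have h1 : ‖InnerProductSpace.toDual ℝ (Lp ℝ 2 ν)
        (indicatorConstLp 2 (hU n) (hνfin _) (1 : ℝ))‖ ≤ R := by
      rw [LinearIsometryEquiv.norm_map]
      refine norm_indicatorConstLp_le.trans ?_
      rw [norm_one, one_mul]
      exact Real.rpow_le_rpow measureReal_nonneg (measureReal_mono (subset_univ _) (hνfin _))
        (by positivity)
    exact mem_closedBall_zero_iff.2 h1
  obtain ⟨Φ, -, hΦ⟩ := (WeakDual.isCompact_closedBall (𝕜 := ℝ) 0 R).ultrafilter_le_nhds (l.map φ)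
    (le_principal_iff.2 (mem_map.2 (Filter.Eventually.of_forall hmem)))
  have hlim : ∀ g : Lp ℝ 2 ν, Tendsto (fun n => ∫ s in U n, g s ∂ν) l (𝓝 (Φ g)) := fun g => by
    have h1 : Tendsto (fun n => φ n g) l (𝓝 (Φ g)) :=
      ((WeakDual.eval_continuous g).tendsto Φ).comp hΦ
    simpa only [hφ] using h1
  set G : Lp ℝ 2 ν := (InnerProductSpace.toDual ℝ (Lp ℝ 2 ν)).symm (WeakDual.toStrongDual Φ) with hG
  have hΦG : ∀ g : Lp ℝ 2 ν, Φ g = ∫ s, G s * g s ∂ν := fun g => by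
    have h1 : inner ℝ G g = Φ g := InnerProductSpace.toDual_symm_apply
    rw [← h1, L2.inner_def]
    refine integral_congr_ae (Eventually.of_forall fun s => ?_)
    simp [mul_comm]
  have hGint : Integrable G ν := (Lp.memLp G).integrable (by norm_num)
  -- Testing on indicators squeezes the integral of `G` over `E` between `0` and `ν E`, hence `0 ≤ G
  -- ≤ 1` almost everywhere. The truncation chosen as `F` makes these bounds hold at every point.
  have hset : ∀ E : Set ℝ, MeasurableSet E →
      Tendsto (fun n => ν.real (E ∩ U n)) l (𝓝 (∫ s in E, G s ∂ν)) := fun E hE => by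
    have h1 := hlim (indicatorConstLp 2 hE (hνfin _) (1 : ℝ))
    have h2 : Φ (indicatorConstLp 2 hE (hνfin _) (1 : ℝ)) = ∫ s in E, G s ∂ν := by
      have h3 : inner ℝ G (indicatorConstLp 2 hE (hνfin _) (1 : ℝ)) = Φ _ :=
        InnerProductSpace.toDual_symm_apply
      rw [← h3, real_inner_comm, L2.inner_indicatorConstLp_one]
    rw [h2] at h1
    refine h1.congr fun n => ?_
    rw [setIntegral_indicatorConstLp (hU n) hE, smul_eq_mul, mul_one]
  have hG0 : 0 ≤ᵐ[ν] G := ae_nonneg_of_forall_setIntegral_nonneg hGint fun E hE _ =>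
    ge_of_tendsto (hset E hE) (Eventually.of_forall fun n => measureReal_nonneg)
  have hG1 : G ≤ᵐ[ν] fun _ => (1 : ℝ) :=
    ae_le_of_forall_setIntegral_le hGint (integrable_const _) fun E hE _ => by
      refine le_of_tendsto (hset E hE) (Eventually.of_forall fun n => ?_)
      rw [setIntegral_const, smul_eq_mul, mul_one]
      exact measureReal_mono inter_subset_left (hνfin _)
  refine ⟨fun s => max 0 (min 1 (G s)), ?_, fun s => ⟨le_max_left _ _, ?_⟩, fun g hg => ?_⟩
  · exact measurable_const.max (measurable_const.min (Lp.stronglyMeasurable G).measurable)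
  · exact max_le zero_le_one (min_le_left _ _)
  · have hgL : MemLp g 2 ν := by
      obtain ⟨C, hC⟩ := isCompact_Icc.exists_bound_of_continuousOn hg
      exact MemLp.of_bound (hg.aestronglyMeasurable measurableSet_Icc) C
        ((ae_restrict_iff' measurableSet_Icc).2 (Eventually.of_forall hC))
    have h1 := hlim hgL.toLp
    have h2 : Φ hgL.toLp = ∫ s in Icc a b, max 0 (min 1 (G s)) * g s := by
      rw [hΦG]
      refine integral_congr_ae ?_
      filter_upwards [hG0, hG1, hgL.coeFn_toLp] with s h3 h4 h5
      rw [h5, min_eq_right h4, max_eq_right (show (0 : ℝ) ≤ G s from h3)]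
    rw [← h2]
    refine h1.congr fun n => ?_
    rw [← Measure.restrict_restrict (hU n)]
    exact integral_congr_ae (ae_restrict_of_ae hgL.coeFn_toLp)

/-- Along an ultrafilter, a sequence of finitely supported probability measures on `[a,b]` converges
weakly. -/
lemma exists_measure_limit {a b : ℝ} (l : Ultrafilter ℕ) {t : ℕ → Finset ℕ} {p c : ℕ → ℕ → ℝ}
    (hp : ∀ n, ∀ k ∈ t n, 0 ≤ p n k) (hp1 : ∀ n, ∑ k ∈ t n, p n k = 1)
    (hc : ∀ n, ∀ k ∈ t n, c n k ∈ Icc a b) :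
    ∃ μ ∈ probMeasures a b, ∀ g : ℝ → ℝ, ContinuousOn g (Icc a b) →
      Tendsto (fun n => ∑ k ∈ t n, p n k * g (c n k)) l (𝓝 (∫ s in Icc a b, g s ∂μ)) := by
  have hab : a ≤ b := by
    obtain ⟨k, hk⟩ : (t 0).Nonempty := by
      by_contra h
      have := hp1 0
      rw [Finset.not_nonempty_iff_eq_empty.1 h] at this
      simp at this
    exact (hc 0 k hk).1.trans (hc 0 k hk).2
  -- The measures are placed on the subtype because it is a compact space, so its space of
  -- probability measures is compact; the limit is pushed forward to the line at the end.
  let m : ℕ → Measure (Icc a b) := fun n =>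
    ∑ k ∈ t n, ENNReal.ofReal (p n k) • Measure.dirac (projIcc a b hab (c n k))
  have hm : ∀ n, IsProbabilityMeasure (m n) := fun n => ⟨by
    simp only [m, Measure.coe_finsetSum, Finset.sum_apply, Measure.smul_apply, measure_univ,
      smul_eq_mul, mul_one]
    rw [← ENNReal.ofReal_sum_of_nonneg (hp n), hp1, ENNReal.ofReal_one]⟩
  let P : ℕ → ProbabilityMeasure (Icc a b) := fun n => ⟨m n, hm n⟩
  obtain ⟨μ, -, hμ⟩ := isCompact_univ.ultrafilter_le_nhds (l.map P) (by simp)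
  have hμ' := ProbabilityMeasure.tendsto_iff_forall_integral_tendsto.1
    (show Tendsto P l (𝓝 μ) from hμ)
  have hemb : MeasurableEmbedding (Subtype.val : Icc a b → ℝ) :=
    MeasurableEmbedding.subtype_coe measurableSet_Icc
  have hcompl : (μ : Measure (Icc a b)).map Subtype.val (Icc a b)ᶜ = 0 := by
    rw [hemb.map_apply]
    convert measure_empty (μ := (μ : Measure (Icc a b)))
    ext x
    simp
  refine ⟨(μ : Measure (Icc a b)).map Subtype.val,
    ⟨Measure.isProbabilityMeasure_map hemb.measurable.aemeasurable, hcompl⟩, fun g hg => ?_⟩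
  have hres : ((μ : Measure (Icc a b)).map Subtype.val).restrict (Icc a b) = _ :=
    Measure.restrict_eq_self_of_ae_mem (mem_ae_iff.2 hcompl)
  rw [hres, hemb.integral_map]
  let gc : C(Icc a b, ℝ) := ⟨fun x => g x, continuousOn_iff_continuous_domRestrict.1 hg⟩
  refine (hμ' (BoundedContinuousFunction.mkOfCompact gc)).congr fun n => ?_
  change ∫ x : Icc a b, g x ∂(m n) = _
  simp only [m]
  rw [integral_finsetSum_measure]
  · refine Finset.sum_congr rfl fun k hk => ?_
    rw [integral_smul_measure, integral_dirac, ENNReal.toReal_ofReal (hp n k hk), smul_eq_mul,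
      projIcc_of_mem hab (hc n k hk)]
  · intro k hk
    exact (integrable_dirac (by simp)).smul_measure ENNReal.ofReal_ne_top

end Compactness

/-! ### Approximation on a grid -/

section Approximation

open Filter Topology

lemma intervalIntegrable_of_mem_Icc {F : ℝ → ℝ} (hF : Measurable F)
    (hF1 : ∀ s, F s ∈ Icc (0 : ℝ) 1) (c d : ℝ) : IntervalIntegrable F volume c d := by
  rw [intervalIntegrable_iff]
  refine Measure.integrableOn_of_bounded (M := 1) measure_Ioc_lt_top.ne hF.aestronglyMeasurable ?_
  exact Eventually.of_forall fun s => by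
    rw [Real.norm_eq_abs, abs_of_nonneg (hF1 s).1]; exact (hF1 s).2

lemma integral_mem_Icc {F : ℝ → ℝ} (hF : Measurable F) (hF1 : ∀ s, F s ∈ Icc (0 : ℝ) 1)
    {c e : ℝ} (hce : c ≤ e) : ∫ s in c..e, F s ∈ Icc 0 (e - c) := by
  refine ⟨intervalIntegral.integral_nonneg hce fun s _ => (hF1 s).1, ?_⟩
  have h := intervalIntegral.integral_mono_on hce (intervalIntegrable_of_mem_Icc hF hF1 c e)
    (intervalIntegrable_const (c := (1 : ℝ))) fun s _ => (hF1 s).2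
  simpa using h

/-- Replacing a density by an interval of the same mass changes the integral of a function that is
nearly constant by little. -/
lemma abs_integral_sub_integral_mul_le {F g : ℝ → ℝ} (hF : Measurable F)
    (hF1 : ∀ s, F s ∈ Icc (0 : ℝ) 1) {c e y ε : ℝ} (hce : c ≤ e) (hg : ContinuousOn g (Icc c e))
    (hy : ∀ s ∈ Icc c e, |g s - y| ≤ ε) :
    |(∫ s in c..c + ∫ t in c..e, F t, g s) - ∫ s in c..e, F s * g s| ≤ 2 * ε * (e - c) := by
  obtain ⟨h0, h1⟩ := integral_mem_Icc hF hF1 hce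
  set m := ∫ t in c..e, F t with hm
  have hε : 0 ≤ ε := (abs_nonneg _).trans (hy c ⟨le_rfl, hce⟩)
  have hFi := intervalIntegrable_of_mem_Icc hF hF1 c e
  have hgi : IntervalIntegrable g volume c (c + m) :=
    (hg.mono (by rw [uIcc_of_le (by linarith)]; exact Icc_subset_Icc_right (by linarith))
      ).intervalIntegrable
  have hFg : IntervalIntegrable (fun s => F s * (g s - y)) volume c e :=
    hFi.mul_continuousOn (by rw [uIcc_of_le hce]; exact hg.sub continuousOn_const)
  -- The constant part `y` contributes the same `m * y` to both integrals because the masses agree;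
  -- only the small oscillation `g - y` remains, once on each side.
  have e1 : ∫ s in c..c + m, g s = (∫ s in c..c + m, (g s - y)) + m * y := by
    rw [intervalIntegral.integral_sub hgi intervalIntegrable_const]
    simp
  have e2 : ∫ s in c..e, F s * g s = (∫ s in c..e, F s * (g s - y)) + m * y := by
    rw [hm, ← intervalIntegral.integral_mul_const, ← intervalIntegral.integral_add hFg
      (hFi.mul_const y)]
    exact intervalIntegral.integral_congr fun s _ => by ring
  have b1 : |∫ s in c..c + m, (g s - y)| ≤ ε * (e - c) := by
    have := intervalIntegral.norm_integral_le_of_norm_le_const (a := c) (b := c + m)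
      (f := fun s => g s - y) (C := ε) fun s hs => by
        rw [uIoc_of_le (by linarith)] at hs
        exact hy s ⟨hs.1.le, by linarith [hs.2]⟩
    refine this.trans (mul_le_mul_of_nonneg_left ?_ hε)
    rw [add_sub_cancel_left, abs_of_nonneg h0]
    exact h1
  have b2 : |∫ s in c..e, F s * (g s - y)| ≤ ε * (e - c) := by
    have := intervalIntegral.norm_integral_le_of_norm_le_const (a := c) (b := e)
      (f := fun s => F s * (g s - y)) (C := ε) fun s hs => by
        rw [uIoc_of_le hce] at hs
        rw [norm_mul, Real.norm_eq_abs, Real.norm_eq_abs, abs_of_nonneg (hF1 s).1]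
        exact (mul_le_of_le_one_left (abs_nonneg _) (hF1 s).2).trans (hy s ⟨hs.1.le, hs.2⟩)
    rwa [abs_of_nonneg (sub_nonneg.2 hce)] at this
  rw [e1, e2, add_sub_add_right_eq_sub]
  refine (abs_sub _ _).trans ?_
  linarith

/-- In each cell the density is pushed to the left end as an interval of equal mass. Uniform
continuity makes `g` constant up to `η` on small cells, and the errors `2 * η * mesh` add up to `2 *
η * (b - a) = ε / 2`. -/
lemma tendsto_sum_integral_density {a b : ℝ} (hab : a < b) {F g : ℝ → ℝ} (hF : Measurable F)
    (hF1 : ∀ s, F s ∈ Icc (0 : ℝ) 1) (hg : ContinuousOn g (Icc a b)) :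
    Tendsto (fun n : ℕ => ∑ k ∈ Finset.range (n + 1), ∫ s in gridPoint a b (n + 1) k..
        gridPoint a b (n + 1) k + ∫ t in gridPoint a b (n + 1) k..gridPoint a b (n + 1) (k + 1), F t,
          g s) atTop (𝓝 (∫ s in a..b, F s * g s)) := by
  rw [Metric.tendsto_atTop]
  intro ε hε
  have hba : 0 < b - a := sub_pos.2 hab
  set η : ℝ := ε / (4 * (b - a)) with hη
  have hη0 : 0 < η := by positivity
  obtain ⟨δ, hδ, hδg⟩ := Metric.uniformContinuousOn_iff.1
    (isCompact_Icc.uniformContinuousOn_of_continuous hg) η hη0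
  obtain ⟨N, hN⟩ := exists_nat_gt ((b - a) / δ)
  refine ⟨N, fun n hn => ?_⟩
  have hn0 : (0 : ℝ) < (n + 1 : ℕ) := by positivity
  have hmesh : (b - a) / (n + 1 : ℕ) < δ := by
    rw [div_lt_iff₀ hn0, mul_comm, ← div_lt_iff₀ hδ]
    refine hN.trans ?_
    exact_mod_cast Nat.lt_succ_of_le hn
  have hgp : ∀ k ≤ n + 1, gridPoint a b (n + 1) k ∈ Icc a b := fun k hk =>
    gridPoint_mem hab n.succ_pos hk
  have hcell : ∀ k < n + 1, gridPoint a b (n + 1) k ≤ gridPoint a b (n + 1) (k + 1) ∧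
      Icc (gridPoint a b (n + 1) k) (gridPoint a b (n + 1) (k + 1)) ⊆ Icc a b := fun k hk =>
    ⟨(gridPoint_strictMono hab n.succ_pos (Nat.lt_succ_self k)).le,
      Icc_subset_Icc (hgp k hk.le).1 (hgp (k + 1) hk).2⟩
  have hsum : ∑ k ∈ Finset.range (n + 1), ∫ s in gridPoint a b (n + 1) k..
      gridPoint a b (n + 1) (k + 1), F s * g s = ∫ s in a..b, F s * g s := by
    rw [intervalIntegral.sum_integral_adjacent_intervals, gridPoint_zero, gridPoint_self n.succ_pos]
    intro k hk
    refine (intervalIntegrable_of_mem_Icc hF hF1 _ _).mul_continuousOn (hg.mono ?_)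
    rw [uIcc_of_le (hcell k hk).1]
    exact (hcell k hk).2
  rw [Real.dist_eq, ← hsum, ← Finset.sum_sub_distrib]
  have hle : ∀ k ∈ Finset.range (n + 1), |(∫ s in gridPoint a b (n + 1) k..
        gridPoint a b (n + 1) k + ∫ t in gridPoint a b (n + 1) k..gridPoint a b (n + 1) (k + 1), F t,
          g s) - ∫ s in gridPoint a b (n + 1) k..gridPoint a b (n + 1) (k + 1), F s * g s| ≤
      2 * η * ((b - a) / (n + 1 : ℕ)) := by
    intro k hk
    obtain ⟨h1, h2⟩ := hcell k (Finset.mem_range.1 hk)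
    have h3 := abs_integral_sub_integral_mul_le hF hF1 h1 (hg.mono h2)
      (y := g (gridPoint a b (n + 1) k)) (ε := η) fun s hs => by
        refine (hδg s (h2 hs) _ (h2 ⟨le_rfl, h1⟩) ?_).le
        rw [Real.dist_eq, abs_of_nonneg (sub_nonneg.2 hs.1)]
        have := hs.2
        rw [gridPoint_succ] at this
        linarith
    refine h3.trans_eq ?_
    rw [gridPoint_succ, add_sub_cancel_left]
  calc _ ≤ ∑ k ∈ Finset.range (n + 1), 2 * η * ((b - a) / (n + 1 : ℕ)) :=
        (Finset.abs_sum_le_sum_abs _ _).trans (Finset.sum_le_sum hle)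
    _ = ε / 2 := by
        rw [Finset.sum_const, Finset.card_range, nsmul_eq_mul, hη]
        field_simp
        ring
    _ < ε := half_lt_self hε

/-- A probability measure on `[a,b]` is a weak limit of measures with positive weights on the
grids. -/
lemma exists_weights_tendsto {a b : ℝ} (hab : a < b) {μ : Measure ℝ} (hμ : μ ∈ probMeasures a b) :
    ∃ p : ℕ → ℕ → ℝ, (∀ n, ∀ k ∈ Finset.range (n + 2), 0 < p n k) ∧
      (∀ n, ∑ k ∈ Finset.range (n + 2), p n k = 1) ∧
      ∀ g : ℝ → ℝ, ContinuousOn g (Icc a b) →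
        Tendsto (fun n => ∑ k ∈ Finset.range (n + 2), p n k * g (gridPoint a b (n + 1) k)) atTop
          (𝓝 (∫ s in Icc a b, g s ∂μ)) := by
  have := hμ.1
  have hres : μ.restrict (Icc a b) = μ :=
    Measure.restrict_eq_self_of_ae_mem (mem_ae_iff.2 hμ.2)
  have hae : ∀ᵐ s ∂μ, s ∈ Icc a b := mem_ae_iff.2 hμ.2
  have hba : 0 < b - a := sub_pos.2 hab
  -- Index of the grid point just below `s`. The minimum keeps it in range also for `s` outside
  -- `[a,b]`, which form a null set.
  let r : ℕ → ℝ → ℕ := fun n s => min (n + 1) ⌊(s - a) / ((b - a) / (n + 1 : ℕ))⌋₊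
  have hr : ∀ n, Measurable (r n) := fun n =>
    measurable_const.min (Nat.measurable_floor.comp ((measurable_id.sub_const a).div_const _))
  have hrlt : ∀ n s, r n s ∈ Finset.range (n + 2) := fun n s =>
    Finset.mem_range.2 (Nat.lt_succ_of_le (min_le_left _ _))
  have hrdist : ∀ n, ∀ s ∈ Icc a b, |gridPoint a b (n + 1) (r n s) - s| ≤ (b - a) / (n + 1 : ℕ) := by
    intro n s hs
    have hh : 0 < (b - a) / (n + 1 : ℕ) := div_pos hba (by positivity)
    set t := (s - a) / ((b - a) / (n + 1 : ℕ)) with ht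
    have hs' : s = a + t * ((b - a) / (n + 1 : ℕ)) := by rw [ht, div_mul_cancel₀ _ hh.ne']; ring
    have ht0 : 0 ≤ t := div_nonneg (sub_nonneg.2 hs.1) hh.le
    have ht1 : t ≤ (n + 1 : ℕ) := by
      rw [ht, div_le_iff₀ hh, mul_div_cancel₀ _ (by positivity)]
      linarith [hs.2]
    have hfl : r n s = ⌊t⌋₊ := min_eq_right (by
      have := Nat.floor_le_floor ht1
      rwa [Nat.floor_natCast] at this)
    have h1 := Nat.floor_le ht0
    have h2 := Nat.lt_floor_add_one t
    have h3 : gridPoint a b (n + 1) ⌊t⌋₊ - s = (⌊t⌋₊ - t) * ((b - a) / (n + 1 : ℕ)) := by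
      unfold gridPoint
      linarith
    rw [hfl, h3, abs_mul, abs_of_pos hh]
    refine mul_le_of_le_one_left hh.le ?_
    rw [abs_le]
    constructor <;> linarith
  let m : ℕ → ℕ → ℝ := fun n k => μ.real (r n ⁻¹' {k})
  have hmint : ∀ (n : ℕ) (G : ℕ → ℝ), ∫ s, G (r n s) ∂μ = ∑ k ∈ Finset.range (n + 2), m n k * G k := by
    intro n G
    have h1 : (fun s => G (r n s)) =
        fun s => ∑ k ∈ Finset.range (n + 2), (r n ⁻¹' {k}).indicator (fun _ => G k) s := by
      ext s
      rw [Finset.sum_eq_single_of_mem _ (hrlt n s)]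
      · simp
      · intro k _ hk
        exact indicator_of_notMem (fun h => hk (Eq.symm h)) _
    rw [h1, integral_finsetSum]
    · refine Finset.sum_congr rfl fun k _ => ?_
      rw [integral_indicator_const _ (hr n (measurableSet_singleton k)), smul_eq_mul]
    · exact fun k _ => (integrable_const _).indicator (hr n (measurableSet_singleton k))
  have hm1 : ∀ n, ∑ k ∈ Finset.range (n + 2), m n k = 1 := fun n => by
    simpa using (hmint n fun _ => 1).symm
  -- A grid has `n + 2` points, so `e n` is the uniform weight. It also serves as the vanishing
  -- mixing parameter: adding the share `e n` of the uniform measure makes all weights strictly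
  -- positive, as needed to obtain interlacing zeros.
  let e : ℕ → ℝ := fun n => 1 / ((n : ℝ) + 2)
  have he0 : ∀ n, 0 < e n := fun n => by positivity
  have he1 : ∀ n, e n < 1 := fun n => by
    simp only [e]
    rw [div_lt_one (by positivity)]
    linarith [(Nat.cast_nonneg n : (0 : ℝ) ≤ n)]
  have hee : ∀ n : ℕ, ((n + 2 : ℕ) : ℝ) * e n = 1 := fun n => by
    simp only [e]; push_cast; field_simp
  have hetend : Tendsto e atTop (𝓝 0) := by
    have h2 := (tendsto_const_div_atTop_nhds_zero_nat (1 : ℝ)).comp (tendsto_add_atTop_nat 2)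
    refine h2.congr fun n => ?_
    simp [e]
  refine ⟨fun n k => (1 - e n) * m n k + e n * e n, fun n k _ => ?_, fun n => ?_, fun g hg => ?_⟩
  · have := mul_nonneg (sub_nonneg.2 (he1 n).le) (measureReal_nonneg (μ := μ) (s := r n ⁻¹' {k}))
    exact add_pos_of_nonneg_of_pos this (mul_pos (he0 n) (he0 n))
  · rw [Finset.sum_add_distrib, ← Finset.mul_sum, hm1, Finset.sum_const, Finset.card_range,
      nsmul_eq_mul, ← mul_assoc, hee]
    ring
  · obtain ⟨C, hC⟩ := isCompact_Icc.exists_bound_of_continuousOn hg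
    have hgp : ∀ n, ∀ k ∈ Finset.range (n + 2), gridPoint a b (n + 1) k ∈ Icc a b := fun n k hk =>
      gridPoint_mem hab n.succ_pos (Nat.le_of_lt_succ (Finset.mem_range.1 hk))
    have hmesh : Tendsto (fun n : ℕ => (b - a) / (n + 1 : ℕ)) atTop (𝓝 0) :=
      (tendsto_const_div_atTop_nhds_zero_nat (b - a)).comp (tendsto_add_atTop_nat 1)
    have hmain : Tendsto (fun n => ∫ s, g (gridPoint a b (n + 1) (r n s)) ∂μ) atTop
        (𝓝 (∫ s, g s ∂μ)) := by
      refine tendsto_integral_of_dominated_convergence (fun _ => C) (fun n => ?_)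
        (integrable_const C) (fun n => ?_) ?_
      · exact ((measurable_of_countable fun k => g (gridPoint a b (n + 1) k)).comp
          (hr n)).aestronglyMeasurable
      · exact Eventually.of_forall fun s => hC _ (hgp n _ (hrlt n s))
      · filter_upwards [hae] with s hs
        refine (hg s hs).tendsto.comp (tendsto_nhdsWithin_iff.2 ⟨?_, ?_⟩)
        · rw [tendsto_iff_dist_tendsto_zero]
          exact squeeze_zero (fun _ => dist_nonneg) (fun n => hrdist n s hs) hmesh
        · exact Eventually.of_forall fun n => hgp n _ (hrlt n s)
    have havg : Tendsto (fun n => e n * (e n * ∑ k ∈ Finset.range (n + 2),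
        g (gridPoint a b (n + 1) k))) atTop (𝓝 0) := by
      refine squeeze_zero_norm (a := fun n => e n * C) (fun n => ?_) (by simpa using hetend.mul_const C)
      rw [norm_mul, norm_mul, Real.norm_of_nonneg (he0 n).le]
      refine mul_le_mul_of_nonneg_left ?_ (he0 n).le
      have h1 : ‖∑ k ∈ Finset.range (n + 2), g (gridPoint a b (n + 1) k)‖ ≤ (n + 2 : ℕ) * C := by
        refine (norm_sum_le_of_le _ fun k hk => hC _ (hgp n k hk)).trans_eq ?_
        rw [Finset.sum_const, Finset.card_range, nsmul_eq_mul]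
      refine (mul_le_mul_of_nonneg_left h1 (he0 n).le).trans_eq ?_
      rw [← mul_assoc, mul_comm (e n), hee, one_mul]
    have := ((hetend.const_sub 1).mul hmain).add havg
    rw [sub_zero, one_mul, add_zero] at this
    rw [hres]
    refine this.congr fun n => ?_
    rw [hmint n fun k => g (gridPoint a b (n + 1) k), Finset.mul_sum, Finset.mul_sum, Finset.mul_sum,
      ← Finset.sum_add_distrib]
    exact Finset.sum_congr rfl fun k _ => by ring

end Approximation

/-! ### Existence -/

section Existence

open Filter Topology

variable {φ ψ : ℝ → ℝ} {a b : ℝ}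

/-- This identifies the exponent of the grid formula with an integral over a single set, the form to
which `exists_density_limit` applies. Half-open intervals keep neighbours disjoint even when `d k`
is the next grid point. -/
lemma setIntegral_iUnion_grid (hab : a < b) {n : ℕ} (hn : 0 < n) {d : ℕ → ℝ}
    (hd : ∀ k, d k ∈ Icc (gridPoint a b n k) (gridPoint a b n (k + 1))) {g : ℝ → ℝ}
    (hg : ContinuousOn g (Icc a b)) :
    ∫ s in (⋃ k ∈ Finset.range n, Ioc (gridPoint a b n k) (d k)) ∩ Icc a b, g s =
      ∑ k ∈ Finset.range n, ∫ s in gridPoint a b n k..d k, g s := by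
  have hsub : ∀ k ∈ Finset.range n, Icc (gridPoint a b n k) (d k) ⊆ Icc a b := fun k hk => by
    have hk := Finset.mem_range.1 hk
    exact Icc_subset_Icc (gridPoint_mem hab hn hk.le).1
      ((hd k).2.trans (gridPoint_mem hab hn hk).2)
  rw [inter_eq_left.2 (iUnion₂_subset fun k hk => Ioc_subset_Icc_self.trans (hsub k hk)),
    integral_biUnion_finset _ (fun _ _ => measurableSet_Ioc)]
  · exact Finset.sum_congr rfl fun k _ => (intervalIntegral.integral_of_le (hd k).1).symm
  · have hlt : ∀ i j : ℕ, i < j →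
        Disjoint (Ioc (gridPoint a b n i) (d i)) (Ioc (gridPoint a b n j) (d j)) := by
      intro i j hij
      rw [Set.disjoint_left]
      intro s hs hs'
      have h1 := (gridPoint_strictMono hab hn).monotone (Nat.succ_le_of_lt hij)
      exact absurd (hs.2.trans ((hd i).2.trans h1)) (not_le.2 hs'.1)
    intro i _ j _ hij
    rcases lt_or_gt_of_ne hij with h | h
    · exact hlt i j h
    · exact (hlt j i h).symm
  · exact fun k hk => ((hg.mono (hsub k hk)).integrableOn_compact isCompact_Icc).mono_set
      Ioc_subset_Icc_self

/-- The Cauchy transform of a probability measure has an exponential representation with a density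
in `[0,1]`. -/
lemma IsChart.exists_density (h : IsChart φ ψ) (hab : a < b) {μ : Measure ℝ}
    (hμ : μ ∈ probMeasures a b) :
    ∃ F : ℝ → ℝ, Measurable F ∧ (∀ s, F s ∈ Icc (0 : ℝ) 1) ∧ ∀ X ∉ Icc (φ a) (φ b),
      ∫ s in Icc a b, 1 / (X - φ s) ∂μ =
        1 / (X - φ b) * Real.exp (-∫ s in a..b, F s * (ψ s / (X - φ s))) := by
  obtain ⟨p, hp, hp1, hpt⟩ := exists_weights_tendsto hab hμ
  choose d hd hdX using fun n => h.exists_intervals hab n.succ_pos (hp n) (hp1 n)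
  let l : Ultrafilter ℕ := Ultrafilter.of atTop
  have hl : (l : Filter ℕ) ≤ atTop := Ultrafilter.of_le atTop
  obtain ⟨F, hF, hF1, hFt⟩ := exists_density_limit a b l
    (U := fun n => ⋃ k ∈ Finset.range (n + 1), Ioc (gridPoint a b (n + 1) k) (d n k))
    (fun n => Finset.measurableSet_biUnion _ fun _ _ => measurableSet_Ioc)
  refine ⟨F, hF, hF1, fun X hX => ?_⟩
  -- The Cauchy transforms converge along the whole sequence, the exponents only along the
  -- ultrafilter; there the grid identities pass to the limit.
  have h1 := (hpt _ (h.continuousOn_inv hX)).mono_left hl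
  have h2 := hFt _ (h.continuousOn_logDeriv hX)
  simp_rw [setIntegral_iUnion_grid hab (Nat.succ_pos _) (hd _) (h.continuousOn_logDeriv hX)] at h2
  rw [integral_Icc_eq_integral_Ioc, ← intervalIntegral.integral_of_le hab.le] at h2
  refine tendsto_nhds_unique h1 ?_
  exact ((Real.continuous_exp.tendsto _).comp h2.neg |>.const_mul (1 / (X - φ b))).congr
    fun n => (hdX n X hX).symm

/-- A density in `[0,1]` comes from the Cauchy transform of a probability measure. -/
lemma IsChart.exists_measure (h : IsChart φ ψ) (hab : a < b) {F : ℝ → ℝ} (hF : Measurable F)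
    (hF1 : ∀ s, F s ∈ Icc (0 : ℝ) 1) :
    ∃ μ ∈ probMeasures a b, ∀ X ∉ Icc (φ a) (φ b),
      ∫ s in Icc a b, 1 / (X - φ s) ∂μ =
        1 / (X - φ b) * Real.exp (-∫ s in a..b, F s * (ψ s / (X - φ s))) := by
  -- An interval whose length is the mass of `F` in a cell fits in that cell, since `0 ≤ F ≤ 1`.
  have hd : ∀ n k : ℕ, gridPoint a b (n + 1) k +
      ∫ t in gridPoint a b (n + 1) k..gridPoint a b (n + 1) (k + 1), F t ∈
        Icc (gridPoint a b (n + 1) k) (gridPoint a b (n + 1) (k + 1)) := fun n k => by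
    obtain ⟨h1, h2⟩ := integral_mem_Icc hF hF1
      (gridPoint_strictMono hab n.succ_pos (Nat.lt_succ_self k)).le
    constructor <;> simp only [Nat.succ_eq_add_one] at * <;> linarith
  choose p hp hp1 hpX using fun n => h.exists_weights hab n.succ_pos (hd n)
  let l : Ultrafilter ℕ := Ultrafilter.of atTop
  have hl : (l : Filter ℕ) ≤ atTop := Ultrafilter.of_le atTop
  obtain ⟨μ, hμ, hμt⟩ := exists_measure_limit l (t := fun n => Finset.range (n + 1 + 1)) hp hp1
    (c := fun n k => gridPoint a b (n + 1) k) (a := a) (b := b)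
    fun n k hk => gridPoint_mem hab n.succ_pos (Nat.le_of_lt_succ (Finset.mem_range.1 hk))
  refine ⟨μ, hμ, fun X hX => ?_⟩
  have h1 := hμt _ (h.continuousOn_inv hX)
  have h2 := (tendsto_sum_integral_density hab hF hF1 (h.continuousOn_logDeriv hX)).mono_left hl
  refine tendsto_nhds_unique h1 ?_
  exact ((Real.continuous_exp.tendsto _).comp h2.neg |>.const_mul (1 / (X - φ b))).congr
    fun n => (hpX n X hX).symm

end Existence

/-! ### Uniqueness -/

section Uniqueness

open Filter Topology

variable {φ ψ : ℝ → ℝ} {a b : ℝ}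

/-- A continuous functional that vanishes on the Cauchy kernels with poles to the right of the
interval is zero. -/
lemma IsChart.functional_eq_zero (h : IsChart φ ψ) (Λ : C(Icc a b, ℝ) →L[ℝ] ℝ)
    (hΛ : ∀ X, φ b < X → ∀ g : C(Icc a b, ℝ), (∀ s, g s = 1 / (X - φ s)) → Λ g = 0) : Λ = 0 := by
  let Φ : C(Icc a b, ℝ) := ⟨fun s => φ s, h.continuous.comp continuous_subtype_val⟩
  have hpos : ∀ X, φ b < X → ∀ s : Icc a b, 0 < X - φ s := fun X hX s => by
    have := h.strictMono.monotone s.2.2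
    linarith
  let K : ∀ X, φ b < X → C(Icc a b, ℝ) := fun X hX =>
    ⟨fun s => 1 / (X - φ s), continuous_const.div
      (continuous_const.sub (h.continuous.comp continuous_subtype_val)) fun s => (hpos X hX s).ne'⟩
  have hstep : ∀ k : ℕ, (∀ X (hX : φ b < X), Λ (Φ ^ k * K X hX) = 0) → Λ (Φ ^ k) = 0 ∧
      ∀ X (hX : φ b < X), Λ (Φ ^ (k + 1) * K X hX) = 0 := by
    intro k hk
    -- This is `φ/(X - φ) = X/(X - φ) - 1`. If `Λ` kills `Φ ^ k * K`, then `Λ (Φ ^ (k + 1) * K)`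
    -- equals `-Λ (Φ ^ k)`, independent of `X`; but it tends to `0` as `X → ∞`, so both vanish.
    have hrec : ∀ X (hX : φ b < X), Φ ^ (k + 1) * K X hX = X • (Φ ^ k * K X hX) - Φ ^ k := by
      intro X hX
      ext s
      have := (hpos X hX s).ne'
      simp only [ContinuousMap.mul_apply, ContinuousMap.pow_apply, ContinuousMap.sub_apply,
        ContinuousMap.smul_apply, ContinuousMap.coe_mk, Φ, K, smul_eq_mul]
      field_simp
      ring
    have hval : ∀ X (hX : φ b < X), Λ (Φ ^ k) = -Λ (Φ ^ (k + 1) * K X hX) := fun X hX => by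
      rw [hrec X hX, map_sub, map_smul, hk X hX]
      simp
    have h0 : Λ (Φ ^ k) = 0 := by
      have hKn : ∀ X (hX : φ b < X), ‖K X hX‖ ≤ 1 / (X - φ b) := fun X hX => by
        have hXb := sub_pos.2 hX
        rw [ContinuousMap.norm_le _ (by positivity)]
        intro s
        have h1 := h.strictMono.monotone s.2.2
        change ‖1 / (X - φ s)‖ ≤ _
        rw [Real.norm_of_nonneg (one_div_nonneg.2 (hpos X hX s).le)]
        exact one_div_le_one_div_of_le hXb (by linarith)
      have hlim : Tendsto (fun X : ℝ => ‖Λ‖ * (‖Φ ^ (k + 1)‖ * (1 / (X - φ b)))) atTop (𝓝 0) := by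
        have h1 : Tendsto (fun X : ℝ => 1 / (X - φ b)) atTop (𝓝 0) := by
          simp_rw [one_div]
          exact (tendsto_atTop_add_const_right atTop (-φ b) tendsto_id).inv_tendsto_atTop
        simpa using (h1.const_mul ‖Φ ^ (k + 1)‖).const_mul ‖Λ‖
      rw [← norm_le_zero_iff]
      refine ge_of_tendsto hlim ?_
      filter_upwards [eventually_gt_atTop (φ b)] with X hX
      rw [hval X hX, norm_neg]
      refine (Λ.le_opNorm _).trans (mul_le_mul_of_nonneg_left ?_ (norm_nonneg _))
      exact (norm_mul_le _ _).trans (mul_le_mul_of_nonneg_left (hKn X hX) (norm_nonneg _))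
    refine ⟨h0, fun X hX => ?_⟩
    rw [← neg_eq_zero, ← hval X hX, h0]
  have hall : ∀ k : ℕ, ∀ X (hX : φ b < X), Λ (Φ ^ k * K X hX) = 0 := by
    intro k
    induction k with
    | zero => exact fun X hX => hΛ X hX _ fun s => by simp [K]
    | succ k ih => exact (hstep k ih).2
  have hpoly : ∀ f ∈ Algebra.adjoin ℝ {Φ}, Λ f = 0 := by
    intro f hf
    rw [Algebra.adjoin_singleton_eq_range_aeval] at hf
    obtain ⟨P, rfl⟩ := hf
    change Λ (Polynomial.aeval Φ P) = 0
    rw [Polynomial.aeval_eq_sum_range, map_sum]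
    exact Finset.sum_eq_zero fun k _ => by rw [map_smul, (hstep k (hall k)).1, smul_zero]
  have hdense : (Algebra.adjoin ℝ {Φ}).topologicalClosure = ⊤ := by
    refine ContinuousMap.subalgebra_topologicalClosure_eq_top_of_separatesPoints _ ?_
    intro s t hst
    exact ⟨Φ, ⟨Φ, Algebra.self_mem_adjoin_singleton ℝ Φ, rfl⟩,
      fun he => hst (Subtype.ext (h.strictMono.injective he))⟩
  ext f
  have hf : f ∈ closure (Algebra.adjoin ℝ {Φ} : Set C(Icc a b, ℝ)) := by
    have : f ∈ (Algebra.adjoin ℝ {Φ}).topologicalClosure := by rw [hdense]; trivial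
    exact this
  exact closure_minimal (t := {f | Λ f = 0}) hpoly (isClosed_eq Λ.continuous continuous_const) hf

/-- A bounded charge on `[a,b]` whose Cauchy transform vanishes to the right of the interval
annihilates all continuous functions. -/
lemma IsChart.setIntegral_mul_eq_zero (h : IsChart φ ψ) (hab : a ≤ b) {ν : Measure ℝ}
    [IsFiniteMeasureOnCompacts ν] {D : ℝ → ℝ} (hD : IntegrableOn D (Icc a b) ν)
    (hX : ∀ X, φ b < X → ∫ s in Icc a b, D s * (1 / (X - φ s)) ∂ν = 0) {g : ℝ → ℝ}
    (hg : ContinuousOn g (Icc a b)) : ∫ s in Icc a b, D s * g s ∂ν = 0 := by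
  have hint : ∀ f : C(Icc a b, ℝ), IntegrableOn (fun s => D s * IccExtend hab f s) (Icc a b) ν :=
    fun f => hD.mul_continuousOn (f.continuous.Icc_extend' (h := hab)).continuousOn isCompact_Icc
  let Λ₀ : C(Icc a b, ℝ) →ₗ[ℝ] ℝ :=
    { toFun := fun f => ∫ s in Icc a b, D s * IccExtend hab f s ∂ν
      map_add' := fun f g => by
        rw [← integral_add (hint f) (hint g)]
        exact integral_congr_ae (Eventually.of_forall fun s => mul_add _ _ _)
      map_smul' := fun c f => by
        rw [RingHom.id_apply, smul_eq_mul, ← integral_const_mul]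
        exact integral_congr_ae (Eventually.of_forall fun s => mul_left_comm _ _ _) }
  let Λ : C(Icc a b, ℝ) →L[ℝ] ℝ := Λ₀.mkContinuous (∫ s in Icc a b, ‖D s‖ ∂ν) fun f => by
    rw [← integral_mul_const]
    refine norm_integral_le_of_norm_le (hD.norm.mul_const _) (Eventually.of_forall fun s => ?_)
    rw [norm_mul]
    exact mul_le_mul_of_nonneg_left (f.norm_coe_le_norm _) (norm_nonneg _)
  have hext : ∀ (f : C(Icc a b, ℝ)) (k : ℝ → ℝ), (∀ s : Icc a b, f s = k s) →
      Λ f = ∫ s in Icc a b, D s * k s ∂ν := fun f k hfk =>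
    setIntegral_congr_fun measurableSet_Icc fun s hs => by
      rw [IccExtend_of_mem hab f hs, hfk]
  have hΛ : Λ = 0 := h.functional_eq_zero Λ fun X hXb f hf => by
    rw [hext f (fun s => 1 / (X - φ s)) hf, hX X hXb]
  rw [← hext ⟨fun s => g s, continuousOn_iff_continuous_domRestrict.1 hg⟩ g fun s => rfl, hΛ]
  rfl

/-- A probability measure on `[a,b]` is determined by its Cauchy transform to the right of the
interval. -/
lemma IsChart.measure_unique (h : IsChart φ ψ) (hab : a ≤ b) {μ ν : Measure ℝ}
    (hμ : μ ∈ probMeasures a b) (hν : ν ∈ probMeasures a b)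
    (hX : ∀ X, φ b < X → ∫ s in Icc a b, 1 / (X - φ s) ∂μ = ∫ s in Icc a b, 1 / (X - φ s) ∂ν) :
    μ = ν := by
  have := hμ.1
  have := hν.1
  have hμr : μ.restrict (Icc a b) = μ := Measure.restrict_eq_self_of_ae_mem (mem_ae_iff.2 hμ.2)
  have hνr : ν.restrict (Icc a b) = ν := Measure.restrict_eq_self_of_ae_mem (mem_ae_iff.2 hν.2)
  -- The difference `μ - ν` is written as a density against the common dominating measure `μ + ν`,
  -- so that `setIntegral_mul_eq_zero` applies.
  let f : ℝ → ENNReal := μ.rnDeriv (μ + ν)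
  let f' : ℝ → ENNReal := ν.rnDeriv (μ + ν)
  have hle : μ ≪ μ + ν := Measure.AbsolutelyContinuous.rfl.add_right ν
  have hle' : ν ≪ μ + ν := by rw [add_comm]; exact Measure.AbsolutelyContinuous.rfl.add_right μ
  have hd : ∀ g : ℝ → ℝ, ∫ s in Icc a b, (f s).toReal * g s ∂(μ + ν) = ∫ s in Icc a b, g s ∂μ :=
    fun g => by simpa using setIntegral_rnDeriv_smul (f := g) hle measurableSet_Icc
  have hd' : ∀ g : ℝ → ℝ, ∫ s in Icc a b, (f' s).toReal * g s ∂(μ + ν) = ∫ s in Icc a b, g s ∂ν :=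
    fun g => by simpa using setIntegral_rnDeriv_smul (f := g) hle' measurableSet_Icc
  have hi : IntegrableOn (fun s => (f s).toReal) (Icc a b) (μ + ν) :=
    Measure.integrable_toReal_rnDeriv.integrableOn
  have hi' : IntegrableOn (fun s => (f' s).toReal) (Icc a b) (μ + ν) :=
    Measure.integrable_toReal_rnDeriv.integrableOn
  have hsub : ∀ g : ℝ → ℝ, ContinuousOn g (Icc a b) →
      ∫ s in Icc a b, ((f s).toReal - (f' s).toReal) * g s ∂(μ + ν) =
        ∫ s in Icc a b, g s ∂μ - ∫ s in Icc a b, g s ∂ν := fun g hg => by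
    rw [← hd, ← hd', ← integral_sub (hi.mul_continuousOn hg isCompact_Icc)
      (hi'.mul_continuousOn hg isCompact_Icc)]
    exact integral_congr_ae (Eventually.of_forall fun s => sub_mul _ _ _)
  have hcont : ∀ X, φ b < X → ContinuousOn (fun s => 1 / (X - φ s)) (Icc a b) := fun X hXb =>
    h.continuousOn_inv fun hm => absurd hm.2 (not_le.2 hXb)
  refine ext_of_forall_integral_eq_of_IsFiniteMeasure fun g => ?_
  rw [← hμr, ← hνr, ← sub_eq_zero, ← hsub g g.continuous.continuousOn]
  refine h.setIntegral_mul_eq_zero hab (hi.sub hi') (fun X hXb => ?_) g.continuous.continuousOn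
  exact (hsub _ (hcont X hXb)).trans (sub_eq_zero.2 (hX X hXb))

/-- A density on `[a,b]` is determined by the exponential formula to the right of the interval. -/
lemma IsChart.density_unique (h : IsChart φ ψ) (hab : a ≤ b) {F G : ℝ → ℝ} (hF : Measurable F)
    (hF1 : ∀ s, F s ∈ Icc (0 : ℝ) 1) (hG : Measurable G) (hG1 : ∀ s, G s ∈ Icc (0 : ℝ) 1)
    (hX : ∀ X, φ b < X →
      Real.exp (-∫ s in a..b, F s * (ψ s / (X - φ s))) =
        Real.exp (-∫ s in a..b, G s * (ψ s / (X - φ s)))) :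
    ∀ᵐ s, s ∈ Ioo a b → F s = G s := by
  have hFi : IntegrableOn F (Icc a b) :=
    (intervalIntegrable_iff_integrableOn_Icc_of_le hab).1 (intervalIntegrable_of_mem_Icc hF hF1 a b)
  have hGi : IntegrableOn G (Icc a b) :=
    (intervalIntegrable_iff_integrableOn_Icc_of_le hab).1 (intervalIntegrable_of_mem_Icc hG hG1 a b)
  have hDi : IntegrableOn (fun s => (F s - G s) * ψ s) (Icc a b) :=
    (hFi.sub hGi).mul_continuousOn h.continuous_deriv.continuousOn isCompact_Icc
  have hzero : ∀ g : ℝ → ℝ, ContinuousOn g (Icc a b) →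
      ∫ s in Icc a b, (F s - G s) * ψ s * g s = 0 := fun g hg => by
    refine h.setIntegral_mul_eq_zero hab hDi (fun X hXb => ?_) hg
    have hc : ContinuousOn (fun s => ψ s / (X - φ s)) (Icc a b) :=
      h.continuousOn_logDeriv fun hm => absurd hm.2 (not_le.2 hXb)
    have h1 := neg_injective (Real.exp_injective (hX X hXb))
    rw [intervalIntegral.integral_of_le hab, intervalIntegral.integral_of_le hab,
      ← integral_Icc_eq_integral_Ioc, ← integral_Icc_eq_integral_Ioc, ← sub_eq_zero,
      ← integral_sub (hFi.mul_continuousOn hc isCompact_Icc)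
        (hGi.mul_continuousOn hc isCompact_Icc)] at h1
    rw [← h1]
    exact integral_congr_ae (Eventually.of_forall fun s => by ring)
  -- `(F - G) * ψ` annihilates all smooth functions compactly supported in `(a,b)`, hence vanishes
  -- almost everywhere there; `ψ > 0` is then cancelled.
  have hae := isOpen_Ioo.ae_eq_zero_of_integral_contDiff_smul_eq_zero (U := Ioo a b) (μ := volume)
    (hDi.mono_set Ioo_subset_Icc_self).locallyIntegrableOn fun g hg _ hgs => by
      rw [← hzero g hg.continuous.continuousOn, ← setIntegral_eq_integral_of_forall_compl_eq_zero
        (s := Icc a b)]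
      · exact integral_congr_ae (Eventually.of_forall fun s => by simp [mul_comm])
      · intro s hs
        rw [image_eq_zero_of_notMem_tsupport fun hm => hs (Ioo_subset_Icc_self (hgs hm)), zero_smul]
  filter_upwards [hae] with s hs hs'
  have := hs hs'
  exact sub_eq_zero.1 ((mul_eq_zero.1 this).resolve_right (h.deriv_pos s).ne')

end Uniqueness

/-! ### Diagrams and their Rayleigh functions -/

section Diagrams

open Filter Topology

variable {a b : ℝ} {w : ℝ → ℝ}

lemma lipschitzWith_of_mem (hw : w ∈ diagrams a b) : LipschitzWith 1 w :=
  LipschitzWith.of_dist_le_mul fun s t => by simpa [Real.dist_eq] using hw.1.1 s t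

lemma measurable_rayleighFunction (w : ℝ → ℝ) : Measurable (rayleighFunction w) :=
  ((measurable_deriv w).const_add 1).div_const 2

lemma rayleighFunction_mem_Icc (hw : w ∈ diagrams a b) (s : ℝ) :
    rayleighFunction w s ∈ Icc (0 : ℝ) 1 := by
  have h := abs_le.1 (norm_deriv_le_of_mem hw s)
  unfold rayleighFunction
  constructor <;> linarith [h.1, h.2]

/-- The formula is given only outside `[a,b]`; continuity carries it to the endpoint. -/
lemma eq_abs_sub_left {s₀ : ℝ} (hw : w ∈ diagrams a b) (h : ∀ s ∉ Icc a b, w s = |s - s₀|) :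
    w a = |a - s₀| := by
  have hcl : IsClosed {s | w s = |s - s₀|} :=
    isClosed_eq (lipschitzWith_of_mem hw).continuous (by fun_prop)
  have hsub : Iio a ⊆ {s | w s = |s - s₀|} := fun s hs => h s fun hm => absurd hs (not_lt.2 hm.1)
  exact closure_minimal hsub hcl (by rw [closure_Iio]; exact self_mem_Iic)

lemma eq_abs_sub_right {s₀ : ℝ} (hw : w ∈ diagrams a b) (h : ∀ s ∉ Icc a b, w s = |s - s₀|) :
    w b = |b - s₀| := by
  have hcl : IsClosed {s | w s = |s - s₀|} :=
    isClosed_eq (lipschitzWith_of_mem hw).continuous (by fun_prop)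
  have hsub : Ioi b ⊆ {s | w s = |s - s₀|} := fun s hs => h s fun hm => absurd hs (not_lt.2 hm.2)
  exact closure_minimal hsub hcl (by rw [closure_Ioi]; exact self_mem_Ici)

/-- The chosen center and `s₀` are compared at a point so far to the right that both formulas hold
and both absolute values open with a plus sign. -/
lemma center_eq {s₀ : ℝ} (hw : w ∈ diagrams a b) (h : ∀ s ∉ Icc a b, w s = |s - s₀|) :
    center w = s₀ := by
  have hex := hw.1.2
  have hc : center w = hex.choose := by unfold center; rw [dif_pos hex]
  obtain ⟨C, hC⟩ := hex.choose_spec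
  rw [← hc] at hC
  set s := |C| + |b| + |s₀| + |center w| + 1
  have h1 := le_abs_self C
  have h2 := le_abs_self b
  have h3 := le_abs_self s₀
  have h4 := le_abs_self (center w)
  have h5 := abs_nonneg C
  have h6 := abs_nonneg b
  have h7 := abs_nonneg s₀
  have h8 := abs_nonneg (center w)
  have e1 := hC s ((by linarith : C ≤ s).trans (le_abs_self s))
  have e2 := h s fun hm => by linarith [hm.2]
  rw [e1, abs_of_nonneg (by linarith), abs_of_nonneg (by linarith)] at e2
  linarith

lemma integral_deriv_eq_sub_of_mem (hw : w ∈ diagrams a b) (c d : ℝ) :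
    ∫ s in c..d, deriv w s = w d - w c :=
  ((lipschitzWith_of_mem hw).lipschitzOnWith.absolutelyContinuousOnInterval).integral_deriv_eq_sub

lemma integral_rayleighFunction (hw : w ∈ diagrams a b) (c d : ℝ) :
    ∫ s in c..d, rayleighFunction w s = (d - c + (w d - w c)) / 2 := by
  have h1 : IntervalIntegrable (deriv w) volume c d :=
    ((lipschitzWith_of_mem hw).lipschitzOnWith.absolutelyContinuousOnInterval).intervalIntegrable_deriv
  unfold rayleighFunction
  rw [intervalIntegral.integral_div, intervalIntegral.integral_add intervalIntegrable_const h1,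
    integral_deriv_eq_sub_of_mem hw]
  simp

lemma integral_rayleighFunction_eq {s₀ : ℝ} (hw : w ∈ diagrams a b) (hs₀ : s₀ ∈ Icc a b)
    (h : ∀ s ∉ Icc a b, w s = |s - s₀|) : ∫ s in a..b, rayleighFunction w s = b - s₀ := by
  rw [integral_rayleighFunction hw, eq_abs_sub_left hw h, eq_abs_sub_right hw h,
    abs_of_nonneg (sub_nonneg.2 hs₀.2), abs_of_nonpos (sub_nonpos.2 hs₀.1)]
  ring

/-- A diagram is determined by its Rayleigh function. -/
lemma diagram_unique {v : ℝ → ℝ} (hab : a ≤ b) (hw : w ∈ diagrams a b) (hv : v ∈ diagrams a b)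
    (h : ∀ᵐ s, s ∈ Ioo a b → rayleighFunction w s = rayleighFunction v s) : w = v := by
  obtain ⟨s₀, hs₀, hws⟩ := hw.2
  obtain ⟨t₀, ht₀, hvt⟩ := hv.2
  have hint : ∀ d ∈ Icc a b, ∫ s in a..d, rayleighFunction w s = ∫ s in a..d, rayleighFunction v s := by
    intro d hd
    rw [intervalIntegral.integral_of_le hd.1, intervalIntegral.integral_of_le hd.1,
      integral_Ioc_eq_integral_Ioo, integral_Ioc_eq_integral_Ioo]
    refine setIntegral_congr_ae measurableSet_Ioo ?_
    filter_upwards [h] with s hs hs'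
    exact hs ⟨hs'.1, hs'.2.trans_le hd.2⟩
  have h0 : s₀ = t₀ := by
    have := hint b ⟨hab, le_rfl⟩
    rw [integral_rayleighFunction_eq hw hs₀ hws, integral_rayleighFunction_eq hv ht₀ hvt] at this
    linarith
  subst h0
  funext s
  by_cases hs : s ∈ Icc a b
  · have := hint s hs
    rw [integral_rayleighFunction hw, integral_rayleighFunction hv, eq_abs_sub_left hw hws,
      eq_abs_sub_left hv hvt] at this
    linarith
  · rw [hws s hs, hvt s hs]

/-- Every density with values in `[0,1]` is the Rayleigh function of a diagram. -/
lemma exists_diagram (hab : a ≤ b) {F : ℝ → ℝ} (hF : Measurable F)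
    (hF1 : ∀ s, F s ∈ Icc (0 : ℝ) 1) :
    ∃ w ∈ diagrams a b, ∀ᵐ s, s ∈ Icc a b → rayleighFunction w s = F s := by
  -- Extending by `0` and `1` gives slope `2 * G - 1` equal to `-1` left of `a` and `1` right of
  -- `b`.
  let G : ℝ → ℝ := fun s => if s ∈ Icc a b then F s else if s < a then 0 else 1
  have hG : Measurable G := Measurable.ite measurableSet_Icc hF
    (Measurable.ite measurableSet_Iio measurable_const measurable_const)
  have hG1 : ∀ s, G s ∈ Icc (0 : ℝ) 1 := fun s => by
    simp only [G]
    split_ifs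
    exacts [hF1 s, ⟨le_rfl, zero_le_one⟩, ⟨zero_le_one, le_rfl⟩]
  have hGi := intervalIntegrable_of_mem_Icc hG hG1
  have hgi : ∀ c d, IntervalIntegrable (fun s => 2 * G s - 1) volume c d := fun c d =>
    ((hGi c d).const_mul 2).sub intervalIntegrable_const
  set m := ∫ s in a..b, G s with hm
  obtain ⟨hm0, hm1⟩ := integral_mem_Icc hG hG1 hab
  rw [← hm] at hm0 hm1
  -- The mass `m` forces the center to be `b - m`, so the value at `a` must be `b - m - a`.
  let w : ℝ → ℝ := fun s => (b - m - a) + ∫ t in a..s, (2 * G t - 1)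
  have hval : ∀ s, ∫ t in a..s, (2 * G t - 1) = 2 * (∫ t in a..s, G t) - (s - a) := fun s => by
    rw [intervalIntegral.integral_sub ((hGi a s).const_mul 2) intervalIntegrable_const,
      intervalIntegral.integral_const_mul]
    simp
  have hlip : ∀ s t, |w s - w t| ≤ |s - t| := by
    intro s t
    have e : w s - w t = ∫ u in t..s, (2 * G u - 1) := by
      simp only [w]
      rw [add_sub_add_left_eq_sub, intervalIntegral.integral_interval_sub_left (hgi a s) (hgi a t)]
    rw [e]
    have := intervalIntegral.norm_integral_le_of_norm_le_const (a := t) (b := s)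
      (f := fun u => 2 * G u - 1) (C := 1) fun u _ => by
        rw [Real.norm_eq_abs, abs_le]
        constructor <;> linarith [(hG1 u).1, (hG1 u).2]
    simpa using this
  have hout : ∀ s ∉ Icc a b, w s = |s - (b - m)| := by
    intro s hs
    simp only [w]
    rw [hval]
    rcases not_and_or.1 hs with h | h
    · have h := not_le.1 h
      have h0 : ∫ t in a..s, G t = 0 := by
        rw [intervalIntegral.integral_symm, neg_eq_zero, intervalIntegral.integral_of_le h.le,
          integral_Ioc_eq_integral_Ioo]
        refine setIntegral_eq_zero_of_forall_eq_zero fun t ht => ?_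
        simp only [G]
        rw [if_neg fun hm => absurd ht.2 (not_lt.2 hm.1), if_pos ht.2]
      rw [h0, abs_of_nonpos (by linarith)]
      ring
    · have h := not_le.1 h
      have h0 : ∫ t in b..s, G t = s - b := by
        have : ∫ t in b..s, G t = ∫ t in b..s, (1 : ℝ) := by
          rw [intervalIntegral.integral_of_le h.le, intervalIntegral.integral_of_le h.le]
          refine setIntegral_congr_fun measurableSet_Ioc fun t ht => ?_
          simp only [G]
          rw [if_neg fun hm => absurd ht.1 (not_lt.2 hm.2), if_neg (not_lt.2 (hab.trans ht.1.le))]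
        rw [this]
        simp
      rw [← intervalIntegral.integral_add_adjacent_intervals (hGi a b) (hGi b s), h0, ← hm,
        abs_of_nonneg (by linarith)]
      ring
  have hw : w ∈ diagrams a b := by
    refine ⟨⟨hlip, b - m, |a| + |b| + 1, fun s hs => hout s fun hmem => ?_⟩, b - m,
      ⟨by linarith, by linarith⟩, hout⟩
    have h1 : |s| ≤ |a| + |b| := by
      rw [abs_le]
      constructor
      · linarith [neg_abs_le a, abs_nonneg b, hmem.1]
      · linarith [le_abs_self b, abs_nonneg a, hmem.2]
    linarith
  refine ⟨w, hw, ?_⟩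
  have hloc : LocallyIntegrable (fun s => 2 * G s - 1) volume := by
    rw [locallyIntegrable_iff]
    intro K hK
    obtain ⟨R, hR⟩ := hK.isBounded.subset_closedBall 0
    rw [Real.closedBall_eq_Icc] at hR
    refine IntegrableOn.mono_set ?_ hR
    by_cases hle : (0 : ℝ) - R ≤ 0 + R
    · exact (intervalIntegrable_iff_integrableOn_Icc_of_le hle).1 (hgi _ _)
    · rw [Icc_eq_empty hle]
      exact integrableOn_empty
  filter_upwards [LocallyIntegrable.ae_hasDerivAt_integral hloc] with s hs hsab
  have hd : deriv w s = 2 * G s - 1 := ((hs a).const_add (b - m - a)).deriv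
  unfold rayleighFunction
  rw [hd]
  simp only [G]
  rw [if_pos hsab]
  ring

lemma deriv_charge_ae (hw : w ∈ diagrams a b) :
    ∀ᵐ s, deriv (charge w) s = rayleighFunction w s - (Ioi (0 : ℝ)).indicator 1 s := by
  have h0 : ∀ᵐ s : ℝ, s ≠ 0 := by simp [ae_iff, measure_singleton]
  filter_upwards [(lipschitzWith_of_mem hw).ae_differentiableAt, h0] with s hs hs0
  unfold rayleighFunction
  rcases lt_or_gt_of_ne hs0 with h | h
  · have hd : HasDerivAt (charge w) ((deriv w s - -1) / 2) s :=
      (hs.hasDerivAt.sub (hasDerivAt_abs_neg h)).div_const 2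
    rw [hd.deriv, indicator_of_notMem (by simpa using h.le)]
    ring
  · have hd : HasDerivAt (charge w) ((deriv w s - 1) / 2) s :=
      (hs.hasDerivAt.sub (hasDerivAt_abs_pos h)).div_const 2
    rw [hd.deriv, indicator_of_mem (show s ∈ Ioi (0 : ℝ) from h)]
    rw [Pi.one_apply]
    ring

/-- The integral against the charge of a diagram, in terms of the Rayleigh function. -/
lemma integral_deriv_charge_mul (ha : a < 0) (hb : 0 < b) (hw : w ∈ diagrams a b) {g : ℝ → ℝ}
    (hg : ContinuousOn g (Icc a b)) :
    ∫ s in a..b, deriv (charge w) s * g s =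
      (∫ s in a..b, rayleighFunction w s * g s) - ∫ s in 0..b, g s := by
  have hab : a ≤ b := (ha.trans hb).le
  have hgi : IntegrableOn g (Ioc a b) := (hg.integrableOn_compact isCompact_Icc).mono_set
    Ioc_subset_Icc_self
  have hFg : IntegrableOn (fun s => rayleighFunction w s * g s) (Ioc a b) := by
    rw [← intervalIntegrable_iff_integrableOn_Ioc_of_le hab]
    exact (intervalIntegrable_of_mem_Icc (measurable_rayleighFunction w)
      (rayleighFunction_mem_Icc hw) a b).mul_continuousOn (by rwa [uIcc_of_le hab])
  rw [intervalIntegral.integral_of_le hab, intervalIntegral.integral_of_le hab,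
    intervalIntegral.integral_of_le hb.le]
  have e : ∫ s in Ioc 0 b, g s = ∫ s in Ioc a b, (Ioi (0 : ℝ)).indicator g s := by
    rw [setIntegral_indicator measurableSet_Ioi, Ioc_inter_Ioi, max_eq_right ha.le]
  rw [e, ← integral_sub hFg (hgi.indicator measurableSet_Ioi)]
  refine integral_congr_ae (ae_restrict_of_ae ?_)
  filter_upwards [deriv_charge_ae hw] with s hs
  rw [hs]
  by_cases h : s ∈ Ioi (0 : ℝ)
  · rw [indicator_of_mem h, indicator_of_mem h, Pi.one_apply]; ring
  · rw [indicator_of_notMem h, indicator_of_notMem h]; ring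

/-- The mass of the Rayleigh function is `b - s₀`, and `1_(0,∞)` removes `b`. This total charge is
the source of the factor `q ^ s₀`. -/
lemma integral_deriv_charge (ha : a < 0) (hb : 0 < b) (hw : w ∈ diagrams a b) :
    ∫ s in a..b, deriv (charge w) s = -center w := by
  obtain ⟨s₀, hs₀, h⟩ := hw.2
  have := integral_deriv_charge_mul ha hb hw (g := fun _ => 1) continuousOn_const
  simp only [mul_one] at this
  rw [this, integral_rayleighFunction_eq hw hs₀ h, center_eq hw h]
  simp

end Diagrams

/-! ### The kernels in terms of a change of variable -/

/-- The variable `q ^ (-s)`, or `s` for `q = 1`. -/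
noncomputable def qChart (q s : ℝ) : ℝ := if q = 1 then s else Real.exp (-Real.log q * s)

/-- The derivative of `qChart`. -/
noncomputable def qChartDeriv (q s : ℝ) : ℝ :=
  if q = 1 then 1 else -Real.log q * Real.exp (-Real.log q * s)

/-- The numerator of the kernel in the variable `qChart`. -/
noncomputable def qFactor (q x : ℝ) : ℝ := if q = 1 then 1 else qChart q x

section QChart

variable {a b q : ℝ} (hq : q ∈ Ioc (0 : ℝ) 1)

include hq

lemma neg_log_pos_of_ne_one (h1 : q ≠ 1) : 0 < -Real.log q :=
  neg_pos.2 (Real.log_neg hq.1 (lt_of_le_of_ne hq.2 h1))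

lemma isChart_qChart : IsChart (qChart q) (qChartDeriv q) := by
  by_cases h1 : q = 1
  · have e1 : qChart q = fun s => s := by ext s; simp [qChart, h1]
    have e2 : qChartDeriv q = fun _ => 1 := by ext s; simp [qChartDeriv, h1]
    rw [e1, e2]
    exact ⟨fun s => hasDerivAt_id s, continuous_const, fun _ => one_pos⟩
  · have e1 : qChart q = fun s => Real.exp (-Real.log q * s) := by ext s; simp [qChart, h1]
    have e2 : qChartDeriv q = fun s => -Real.log q * Real.exp (-Real.log q * s) := by
      ext s; simp [qChartDeriv, h1]
    rw [e1, e2]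
    refine ⟨fun s => ?_, by fun_prop, fun s =>
      mul_pos (neg_log_pos_of_ne_one hq h1) (Real.exp_pos _)⟩
    exact (((hasDerivAt_id s).const_mul (-Real.log q)).exp).congr_deriv (by simp; ring)

omit hq in
lemma qFactor_ne_zero (x : ℝ) : qFactor q x ≠ 0 := by
  unfold qFactor qChart
  split_ifs
  · exact one_ne_zero
  · exact (Real.exp_pos _).ne'

/-- Multiply numerator and denominator by `q ^ (-x)`. From here on the cases `q < 1` and `q = 1` are
treated together. -/
lemma kernel_eq_qFactor_mul (x s : ℝ) :
    kernel q x s = qFactor q x * (1 / (qChart q x - qChart q s)) := by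
  unfold kernel qFactor qChart
  split_ifs with h1
  · rw [one_mul]
  · rw [Real.rpow_def_of_pos hq.1, show Real.log q * (x - s) =
      -Real.log q * s - -Real.log q * x by ring, Real.exp_sub, one_sub_div (Real.exp_pos _).ne',
      one_div_div, mul_one_div]

lemma qChart_notMem {x : ℝ} (hx : x ∉ Icc a b) : qChart q x ∉ Icc (qChart q a) (qChart q b) :=
  fun h => hx ⟨(isChart_qChart hq).strictMono.le_iff_le.1 h.1,
    (isChart_qChart hq).strictMono.le_iff_le.1 h.2⟩

lemma exists_qChart_eq {X : ℝ} (hX : qChart q b < X) : ∃ x, b < x ∧ qChart q x = X := by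
  have hex : ∃ x, qChart q x = X := by
    by_cases h1 : q = 1
    · exact ⟨X, by simp [qChart, h1]⟩
    · have hpos : 0 < X := lt_trans (by simp [qChart, h1, Real.exp_pos]) hX
      refine ⟨Real.log X / -Real.log q, ?_⟩
      rw [qChart, if_neg h1, mul_div_cancel₀ _ (neg_log_pos_of_ne_one hq h1).ne', Real.exp_log hpos]
  obtain ⟨x, rfl⟩ := hex
  exact ⟨x, (isChart_qChart hq).strictMono.lt_iff_lt.1 hX, rfl⟩

lemma hasDerivAt_log_kernel {x s : ℝ} (hx : x ∉ Icc a b) (hs : s ∈ Icc a b) :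
    HasDerivAt (fun t => Real.log (kernel q x t))
      (qChartDeriv q s / (qChart q x - qChart q s)) s := by
  have hc := isChart_qChart hq
  have hne := hc.sub_ne_zero (qChart_notMem hq hx) hs
  have hf := qFactor_ne_zero (q := q) x
  have e : kernel q x = fun t => qFactor q x * (1 / (qChart q x - qChart q t)) := by
    ext t; exact kernel_eq_qFactor_mul hq x t
  rw [e]
  have h1 : HasDerivAt (fun t => qFactor q x * (1 / (qChart q x - qChart q t)))
      (qFactor q x * (qChartDeriv q s / (qChart q x - qChart q s) ^ 2)) s := by
    have h2 := (((hc.hasDerivAt s).const_sub (qChart q x)).fun_inv hne).const_mul (qFactor q x)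
    simp only [one_div]
    exact h2.congr_deriv (by rw [neg_neg])
  refine (h1.log (mul_ne_zero hf (one_div_ne_zero hne))).congr_deriv ?_
  field_simp

/-- The kernel has constant sign on `[a,b]`, so the principal branch differs from the real logarithm
of the absolute value by `0` or `π i` throughout, which differentiation removes. -/
lemma exists_log_kernel_eq {x : ℝ} (hx : x ∉ Icc a b) :
    ∃ C : ℂ, ∀ s ∈ Icc a b,
      Complex.log (kernel q x s : ℂ) = (Real.log (kernel q x s) : ℂ) + C := by
  rcases kernel_sign hq hx with hs | hs
  · exact ⟨0, fun s h => by rw [Complex.ofReal_log (hs s h).le, add_zero]⟩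
  · refine ⟨Real.pi * Complex.I, fun s h => ?_⟩
    have h2 := Complex.log_ofReal_mul (r := -kernel q x s) (x := -1)
      (neg_pos.2 (hs s h)) (by norm_num)
    rw [Complex.log_neg_one, Real.log_neg_eq_log] at h2
    simpa using h2

lemma derivWithin_logKernel (hab : a < b) {x s : ℝ} (hx : x ∉ Icc a b) (hs : s ∈ Icc a b) :
    derivWithin (logKernel hq hx).1 (Icc a b) s =
      ((qChartDeriv q s / (qChart q x - qChart q s) : ℝ) : ℂ) := by
  obtain ⟨C, hC⟩ := exists_log_kernel_eq hq hx
  have h1 : HasDerivWithinAt (logKernel hq hx).1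
      ((qChartDeriv q s / (qChart q x - qChart q s) : ℝ) : ℂ) (Icc a b) s :=
    (((hasDerivAt_log_kernel hq hx hs).ofReal_comp.add_const C).hasDerivWithinAt).congr_of_mem hC hs
  exact h1.derivWithin (uniqueDiffOn_Icc hab s hs)

/-- The choice of branch enters only through the boundary term at `b`, whose exponential is the
kernel itself; so the result is real also for `x < a`. -/
lemma exp_rayleighMeasure (hab : a < b) (w : diagrams a b) {x : ℝ} (hx : x ∉ Icc a b) :
    Complex.exp (rayleighMeasure hab w (logKernel hq hx)) =
      ((kernel q x b * Real.exp (-∫ s in a..b, rayleighFunction w.1 s *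
        (qChartDeriv q s / (qChart q x - qChart q s))) : ℝ) : ℂ) := by
  have hI : ∫ s in a..b, derivWithin (logKernel hq hx).1 (Icc a b) s *
      (rayleighFunction w.1 s : ℂ) = ((∫ s in a..b, rayleighFunction w.1 s *
        (qChartDeriv q s / (qChart q x - qChart q s)) : ℝ) : ℂ) := by
    rw [← intervalIntegral.integral_ofReal]
    refine intervalIntegral.integral_congr fun s hs => ?_
    rw [uIcc_of_le hab.le] at hs
    rw [derivWithin_logKernel hq hab hx hs]
    push_cast
    ring
  have hb : b ∈ Icc a b := ⟨hab.le, le_rfl⟩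
  have hne : kernel q x b ≠ 0 :=
    (kernel_sign hq hx).elim (fun h => (h b hb).ne') (fun h => (h b hb).ne)
  change Complex.exp (Complex.log (kernel q x b : ℂ) - _) = _
  rw [hI, sub_eq_add_neg, Complex.exp_add, Complex.exp_log (by exact_mod_cast hne)]
  push_cast
  ring

/-- The Markov-Krein identity in the variable `qChart`. -/
lemma markovKreinAt_iff (hab : a < b) (μ : Measure ℝ) (w : diagrams a b) {x : ℝ}
    (hx : x ∉ Icc a b) :
    MarkovKreinAt hq μ (rayleighMeasure hab w) hx ↔
      ∫ s in Icc a b, 1 / (qChart q x - qChart q s) ∂μ = 1 / (qChart q x - qChart q b) *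
        Real.exp (-∫ s in a..b, rayleighFunction w.1 s *
          (qChartDeriv q s / (qChart q x - qChart q s))) := by
  unfold MarkovKreinAt
  rw [exp_rayleighMeasure, Complex.ofReal_inj]
  simp_rw [kernel_eq_qFactor_mul hq]
  rw [integral_const_mul, mul_assoc, mul_right_inj' (qFactor_ne_zero x)]

omit hq in
/-- The constant `1 - q`, or `1` for `q = 1`. -/
noncomputable def rConstant (q : ℝ) : ℝ := if q = 1 then 1 else 1 - q

omit hq in
lemma rConstant_ne_zero : rConstant q ≠ 0 := by
  unfold rConstant
  split_ifs with h1
  · exact one_ne_zero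
  · exact sub_ne_zero.2 (Ne.symm h1)

omit hq in
lemma rMeasure_eq (μ : Measure ℝ) (x : ℝ) :
    rMeasure a b q μ x = rConstant q * ∫ s in Icc a b, kernel q x s ∂μ := by
  unfold rMeasure rConstant kernel
  split_ifs with h1
  · rw [one_mul]
  · rfl

lemma rDiagram_eq (ha : a < 0) (hb : 0 < b) {w : ℝ → ℝ} (hw : w ∈ diagrams a b) {x : ℝ}
    (hx : x ∉ Icc a b) :
    rDiagram a b q w x = rConstant q * (qFactor q x * (1 / (qChart q x - qChart q b) *
        Real.exp (-∫ s in a..b, rayleighFunction w s *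
          (qChartDeriv q s / (qChart q x - qChart q s))))) := by
  have hc := isChart_qChart hq
  have hX := qChart_notMem hq hx
  have h0 : (0 : ℝ) ∈ Icc a b := ⟨ha.le, hb.le⟩
  have hbm : b ∈ Icc a b := ⟨(ha.trans hb).le, le_rfl⟩
  have hg := hc.continuousOn_logDeriv hX
  have hneb := hc.sub_ne_zero hX hbm
  have hne0 := hc.sub_ne_zero hX h0
  -- Replacing `F` by `σ' = F - 1_(0,∞)` moves the base point of the prefactor from `b` to `0`,
  -- which lies in `[a,b]`.
  have hσ : 1 / (qChart q x - qChart q b) * Real.exp (-∫ s in a..b, rayleighFunction w s *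
        (qChartDeriv q s / (qChart q x - qChart q s))) =
      1 / (qChart q x - qChart q 0) * Real.exp (-∫ s in a..b, deriv (charge w) s *
        (qChartDeriv q s / (qChart q x - qChart q s))) := by
    rw [integral_deriv_charge_mul ha hb hw hg, neg_sub, Real.exp_sub, Real.exp_neg,
      hc.exp_integral hX h0 hbm]
    field_simp
  rw [hσ]
  unfold rDiagram rConstant
  by_cases h1 : q = 1
  · rw [if_pos h1, if_pos h1]
    have e1 : ∀ t, qChart q t = t := fun t => by simp [qChart, h1]
    have e2 : ∀ t, qChartDeriv q t = 1 := fun t => by simp [qChartDeriv, h1]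
    simp only [e1, e2, qFactor, if_pos h1, one_mul, sub_zero]
    rw [← intervalIntegral.integral_neg]
    congr 2
    refine intervalIntegral.integral_congr fun s _ => ?_
    rw [mul_one_div, ← div_neg, neg_sub]
  · rw [if_neg h1, if_neg h1]
    have hL := integral_deriv_charge ha hb hw
    have hcont : ContinuousOn (fun s => 1 / (1 - q ^ (x - s))) (Icc a b) := by
      have := (contDiffOn_kernel hq hx).continuousOn
      exact this.congr fun s _ => by simp [kernel, h1]
    have hσi : IntervalIntegrable (deriv (charge w)) volume a b := by
      have hi : IntervalIntegrable (fun s => rayleighFunction w s - (Ioi (0 : ℝ)).indicator 1 s)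
          volume a b := by
        refine (intervalIntegrable_of_mem_Icc (measurable_rayleighFunction w)
          (rayleighFunction_mem_Icc hw) a b).sub (intervalIntegrable_of_mem_Icc
            (measurable_one.indicator measurableSet_Ioi) (fun s => ?_) a b)
        by_cases h : s ∈ Ioi (0 : ℝ)
        · rw [indicator_of_mem h]; exact ⟨zero_le_one, le_rfl⟩
        · rw [indicator_of_notMem h]; exact ⟨le_rfl, zero_le_one⟩
      refine hi.congr_ae (ae_restrict_of_ae ?_)
      filter_upwards [deriv_charge_ae hw] with s hs using hs.symm
    -- The logarithmic derivative is `ln q⁻¹` times the kernel minus one; the `-1`, integrated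
    -- against the charge, produces `q ^ s₀`.
    have hker : ∀ s ∈ Icc a b, qChartDeriv q s / (qChart q x - qChart q s) =
        -Real.log q * (1 / (1 - q ^ (x - s)) - 1) := fun s hs => by
      have hne := hc.sub_ne_zero hX hs
      have e := kernel_eq_qFactor_mul hq x s
      rw [kernel, if_neg h1, qFactor, if_neg h1] at e
      have e' : qChartDeriv q s = -Real.log q * qChart q s := by simp [qChartDeriv, qChart, h1]
      rw [e, e']
      field_simp
      ring
    have e3 : ∫ s in a..b, deriv (charge w) s * (qChartDeriv q s / (qChart q x - qChart q s)) =
        -Real.log q * (∫ s in a..b, deriv (charge w) s / (1 - q ^ (x - s))) +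
          -Real.log q * center w := by
      have : ∫ s in a..b, deriv (charge w) s * (qChartDeriv q s / (qChart q x - qChart q s)) =
          ∫ s in a..b, -Real.log q * (deriv (charge w) s * (1 / (1 - q ^ (x - s))) -
            deriv (charge w) s) :=
        intervalIntegral.integral_congr fun s hs => by
          rw [uIcc_of_le (ha.trans hb).le] at hs
          rw [hker s hs]
          ring
      rw [this, intervalIntegral.integral_const_mul, intervalIntegral.integral_sub
        (hσi.mul_continuousOn (by rwa [uIcc_of_le (ha.trans hb).le])) hσi, hL]
      simp only [mul_one_div]
      ring
    have e4 := kernel_eq_qFactor_mul hq x 0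
    rw [kernel, if_neg h1, sub_zero] at e4
    rw [← mul_assoc (qFactor q x), ← e4, e3, Real.log_inv, neg_add, Real.exp_add,
      Real.rpow_def_of_pos hq.1]
    rw [show -(-Real.log q * center w) = Real.log q * center w by ring]
    ring

lemma isTransitionMeasure_iff (ha : a < 0) (hb : 0 < b) (w : diagrams a b) (μ : Measure ℝ) :
    IsTransitionMeasure a b q w.1 μ ↔ MarkovKrein hq μ (rayleighMeasure (ha.trans hb) w) := by
  refine forall₂_congr fun x hx => ?_
  rw [markovKreinAt_iff, rMeasure_eq, rDiagram_eq hq ha hb w.2 hx,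
    mul_right_inj' rConstant_ne_zero]
  simp_rw [kernel_eq_qFactor_mul hq]
  rw [integral_const_mul, mul_right_inj' (qFactor_ne_zero x)]

end QChart

/-! ### The correspondence -/

section Correspondence

variable {a b q : ℝ} (hq : q ∈ Ioc (0 : ℝ) 1) (hab : a < b)

lemma notMem_Icc_of_lt {x : ℝ} (hx : b < x) : x ∉ Icc a b := fun h => absurd h.2 (not_le.2 hx)

include hq hab

lemma exists_diagram_markovKrein {μ : Measure ℝ} (hμ : μ ∈ probMeasures a b) :
    ∃ w : diagrams a b, MarkovKrein hq μ (rayleighMeasure hab w) := by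
  obtain ⟨F, hF, hF1, hX⟩ := (isChart_qChart hq).exists_density hab hμ
  obtain ⟨w, hw, hwF⟩ := exists_diagram hab.le hF hF1
  refine ⟨⟨w, hw⟩, fun x hx => (markovKreinAt_iff hq hab μ _ hx).2 ?_⟩
  rw [hX _ (qChart_notMem hq hx)]
  congr 3
  refine intervalIntegral.integral_congr_ae ?_
  filter_upwards [hwF] with s hs hs'
  rw [uIoc_of_le hab.le] at hs'
  rw [hs ⟨hs'.1.le, hs'.2⟩]

lemma exists_measure_markovKrein (w : diagrams a b) :
    ∃ μ ∈ probMeasures a b, MarkovKrein hq μ (rayleighMeasure hab w) := by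
  obtain ⟨μ, hμ, hX⟩ := (isChart_qChart hq).exists_measure hab (measurable_rayleighFunction w.1)
    (rayleighFunction_mem_Icc w.2)
  exact ⟨μ, hμ, fun x hx => (markovKreinAt_iff hq hab μ _ hx).2 (hX _ (qChart_notMem hq hx))⟩

/-- The identity to the right of the interval determines the diagram. -/
lemma diagram_unique_of_markovKreinAt {μ : Measure ℝ} {w v : diagrams a b}
    (hw : ∀ (x : ℝ) (hx : x ∉ Icc a b), b < x → MarkovKreinAt hq μ (rayleighMeasure hab w) hx)
    (hv : ∀ (x : ℝ) (hx : x ∉ Icc a b), b < x → MarkovKreinAt hq μ (rayleighMeasure hab v) hx) :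
    w = v := by
  have hc := isChart_qChart hq
  refine Subtype.ext (diagram_unique hab.le w.2 v.2 (hc.density_unique hab.le
    (measurable_rayleighFunction w.1) (rayleighFunction_mem_Icc w.2)
    (measurable_rayleighFunction v.1) (rayleighFunction_mem_Icc v.2) fun X hX => ?_))
  obtain ⟨x, hbx, rfl⟩ := exists_qChart_eq hq hX
  have hx : x ∉ Icc a b := notMem_Icc_of_lt hbx
  have h1 := (markovKreinAt_iff hq hab μ w hx).1 (hw x hx hbx)
  have h2 := (markovKreinAt_iff hq hab μ v hx).1 (hv x hx hbx)
  exact mul_left_cancel₀ (one_div_ne_zero (sub_pos.2 hX).ne') (h1.symm.trans h2)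

/-- The identity determines the measure. -/
lemma measure_unique_of_markovKrein {μ ν : Measure ℝ} (hμ : μ ∈ probMeasures a b)
    (hν : ν ∈ probMeasures a b) {w : diagrams a b}
    (h1 : MarkovKrein hq μ (rayleighMeasure hab w)) (h2 : MarkovKrein hq ν (rayleighMeasure hab w)) :
    μ = ν := by
  refine (isChart_qChart hq).measure_unique hab.le hμ hν fun X hX => ?_
  obtain ⟨x, hbx, rfl⟩ := exists_qChart_eq hq hX
  have hx : x ∉ Icc a b := notMem_Icc_of_lt hbx
  rw [(markovKreinAt_iff hq hab μ w hx).1 (h1 x hx), (markovKreinAt_iff hq hab ν w hx).1 (h2 x hx)]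

end Correspondence

end QMarkovKrein

theorem mainTheorem2 (a b q : ℝ) (ha : a < 0) (hb : 0 < b) (hq : q ∈ Set.Ioc (0 : ℝ) 1) :
    -- every probability measure on `[a,b]` corresponds to exactly one Rayleigh measure on `[a,b]`
    (∀ μ ∈ QMarkovKrein.probMeasures a b,
      ∃! τ, τ ∈ QMarkovKrein.rayleighMeasures (ha.trans hb) ∧ QMarkovKrein.MarkovKrein hq μ τ) ∧
    -- every Rayleigh measure on `[a,b]` corresponds to exactly one probability measure on `[a,b]`
    (∀ τ ∈ QMarkovKrein.rayleighMeasures (ha.trans hb),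
      ∃! μ, μ ∈ QMarkovKrein.probMeasures a b ∧ QMarkovKrein.MarkovKrein hq μ τ) ∧
    -- the identity for `x > b`, where all logarithms are real, already gives it for `x ∉ [a,b]`
    (∀ μ ∈ QMarkovKrein.probMeasures a b, ∀ τ ∈ QMarkovKrein.rayleighMeasures (ha.trans hb),
      (∀ (x : ℝ) (hx : x ∉ Set.Icc a b), b < x → QMarkovKrein.MarkovKreinAt hq μ τ hx) →
        QMarkovKrein.MarkovKrein hq μ τ) ∧
    -- the relation `R_μ(x;q) = R_w(x;q)` is the same correspondence
    (∀ (w : QMarkovKrein.diagrams a b), ∀ μ ∈ QMarkovKrein.probMeasures a b,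
      (QMarkovKrein.IsTransitionMeasure a b q w.1 μ ↔
        QMarkovKrein.MarkovKrein hq μ (QMarkovKrein.rayleighMeasure (ha.trans hb) w))) ∧
    -- and it is a bijection between the diagrams and the probability measures
    (∀ w ∈ QMarkovKrein.diagrams a b,
      ∃! μ, μ ∈ QMarkovKrein.probMeasures a b ∧ QMarkovKrein.IsTransitionMeasure a b q w μ) ∧
    (∀ μ ∈ QMarkovKrein.probMeasures a b,
      ∃! w, w ∈ QMarkovKrein.diagrams a b ∧ QMarkovKrein.IsTransitionMeasure a b q w μ) := by
  have hab := ha.trans hb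
  have hunique : ∀ {μ : Measure ℝ} {w v : QMarkovKrein.diagrams a b},
      (∀ (x : ℝ) (hx : x ∉ Set.Icc a b), b < x →
        QMarkovKrein.MarkovKreinAt hq μ (QMarkovKrein.rayleighMeasure hab w) hx) →
      QMarkovKrein.MarkovKrein hq μ (QMarkovKrein.rayleighMeasure hab v) → w = v := fun h1 h2 =>
    QMarkovKrein.diagram_unique_of_markovKreinAt hq hab h1 fun x hx _ => h2 x hx
  have htrans := QMarkovKrein.isTransitionMeasure_iff hq ha hb
  refine ⟨?_, ?_, ?_, fun w μ _ => htrans w μ, ?_, ?_⟩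
  · intro μ hμ
    obtain ⟨w, hw⟩ := QMarkovKrein.exists_diagram_markovKrein hq hab hμ
    refine ⟨_, ⟨⟨w, rfl⟩, hw⟩, ?_⟩
    rintro _ ⟨⟨v, rfl⟩, hv⟩
    rw [hunique (fun x hx _ => hv x hx) hw]
  · rintro _ ⟨w, rfl⟩
    obtain ⟨μ, hμ, hμw⟩ := QMarkovKrein.exists_measure_markovKrein hq hab w
    exact ⟨μ, ⟨hμ, hμw⟩, fun ν hν =>
      QMarkovKrein.measure_unique_of_markovKrein hq hab hν.1 hμ hν.2 hμw⟩
  · rintro μ hμ _ ⟨w, rfl⟩ h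
    -- Some diagram `v` satisfies the full identity with `μ`; since `x > b` already determines the
    -- diagram, it is the given one.
    obtain ⟨v, hv⟩ := QMarkovKrein.exists_diagram_markovKrein hq hab hμ
    rwa [hunique h hv]
  · intro w hw
    obtain ⟨μ, hμ, hμw⟩ := QMarkovKrein.exists_measure_markovKrein hq hab ⟨w, hw⟩
    refine ⟨μ, ⟨hμ, (htrans ⟨w, hw⟩ μ).2 hμw⟩, fun ν hν => ?_⟩
    exact QMarkovKrein.measure_unique_of_markovKrein hq hab hν.1 hμ
      ((htrans ⟨w, hw⟩ ν).1 hν.2) hμw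
  · intro μ hμ
    obtain ⟨w, hw⟩ := QMarkovKrein.exists_diagram_markovKrein hq hab hμ
    refine ⟨w.1, ⟨w.2, (htrans w μ).2 hw⟩, fun v hv => ?_⟩
    exact congrArg Subtype.val
      (hunique (w := ⟨v, hv.1⟩) (fun x hx _ => (htrans ⟨v, hv.1⟩ μ).1 hv.2 x hx) hw)
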